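/- Let $n\ge 1$ and $0<\alpha<n$. For $\mathbf b=(b_1,\dots,b_m)$ and $f$ on $\mathbb R^n$ put $$I_{\alpha,\mathbf b}f(x)=\int_{\mathbb R^n}\prod_{j=1}^m\bigl(b_j(x)-b_j(y)\bigr)\frac{f(y)}{|x-y|^{n-\alpha}}\,dy .$$ A dyadic grid $\mathcal D$ is a family of half-open cubes $\prod_{i=1}^n[a_i,a_i+2^k)$, $k\in\mathbb Z$, such that for each $k$ the subfamily $\mathcal D_k$ of cubes of side length $2^k$ partitions $\mathbb R^n$, any two distinct cubes of $\mathcal D$ are disjoint or one contains the other, each $Q\in\mathcal D_k$ is contained in a unique cube of $\mathcal D_{k+1}$, and each $Q\in\mathcal D_k$ contains exactly $2^n$ cubes of $\mathcal D_{k-1}$. A family $\mathcal S$ of cubes is $\eta$-sparse if there are pairwise disjoint measurable sets $E_Q\subseteq Q$ $(Q\in\mathcal S)$ with $|E_Q|\ge\eta|Q|$. With $(b)_Q=\frac1{|Q|}\int_Q b$, for $\mathcal S\subseteq\mathcal D$ and $\tau\subseteq\{1,\dots,m\}$ let $$T^{\alpha,\tau}_{\mathcal S,\mathbf b}f(x)=\sum_{Q\in\mathcal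 S}|Q|^{\frac\alpha n}\Bigl(\prod_{i\in\tau}|b_i(x)-(b_i)_Q|\Bigr)\Bigl(\frac1{|Q|}\int_Q\prod_{l\notin\tau}|b_l(y)-(b_l)_Q|\,|f(y)|\,dy\Bigr)\chi_Q(x)\in[0,\infty],$$ with the convention $0\cdot\infty=0$. **Lemma.** There is a constant $C=C(n,\alpha)$, and for every $m\ge0$ a number $\eta=\eta(n,\alpha,m)\in(0,1)$, such that for all (real- or complex-valued) $b_1,\dots,b_m\in L^1_{\rm loc}(\mathbb R^n)$ and every bounded (i.e. $L^\infty$) $f$ with compact support there are $3^n$ $\eta$-sparse families $\mathcal S_1,\dots,\mathcal S_{3^n}$, each contained in a dyadic grid, such that for every $x\in\mathbb R^n$ $$|I_{\alpha,\mathbf b}f(x)|\le C\sum_{j=1}^{3^n}\ \sum_{\tau\subseteq\{1,\dots,m\}}T^{\alpha,\tau}_{\mathcal S_j,\mathbf b}f(x),$$ where the integral defining $I_{\alpha,\mathbf b}f(x)$ converges absolutely whenever the right-hand side is finite (where the right-hand side is $+\infty$ nothing is asserted). -/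

import Mathlib

open MeasureTheory
open scoped ENNReal NNReal

noncomputable section

/-- The half-open cube `∏ᵢ [aᵢ, aᵢ + ℓ)` in `ℝⁿ`. -/
def halfOpenCube {n : ℕ} (a : Fin n → ℝ) (ℓ : ℝ) : Set (EuclideanSpace ℝ (Fin n)) :=
  {x | ∀ i, x i ∈ Set.Ico (a i) (a i + ℓ)}

/-- The subfamily `𝒟ₖ` of those members of `𝒟` that are half-open cubes of side length `2 ^ k`. -/
def cubesOfScale {n : ℕ} (D : Set (Set (EuclideanSpace ℝ (Fin n)))) (k : ℤ) :
    Set (Set (EuclideanSpace ℝ (Fin n))) :=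
  {Q | Q ∈ D ∧ ∃ a : Fin n → ℝ, Q = halfOpenCube a ((2 : ℝ) ^ k)}

/-- `D` is a dyadic grid in `ℝⁿ`. -/
structure IsDyadicGrid {n : ℕ} (D : Set (Set (EuclideanSpace ℝ (Fin n)))) : Prop where
  /-- Every member is a half-open cube of side length `2 ^ k` for some integer `k`. -/
  exists_scale : ∀ Q ∈ D, ∃ k : ℤ, Q ∈ cubesOfScale D k
  /-- For every `k`, the cubes of side length `2 ^ k` partition `ℝⁿ`: every point lies in exactly
  one of them. -/
  partition : ∀ k : ℤ, Setoid.IsPartition (cubesOfScale D k)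
  /-- Two distinct cubes are disjoint or one is contained in the other. -/
  nested : ∀ Q ∈ D, ∀ R ∈ D, Q ≠ R → Disjoint Q R ∨ Q ⊆ R ∨ R ⊆ Q
  /-- Every cube has a unique dyadic parent. -/
  parent : ∀ k : ℤ, ∀ Q ∈ cubesOfScale D k, ∃! R, R ∈ cubesOfScale D (k + 1) ∧ Q ⊆ R
  /-- Every cube has exactly `2 ^ n` dyadic children. -/
  children : ∀ k : ℤ, ∀ Q ∈ cubesOfScale D k,
    {R | R ∈ cubesOfScale D (k - 1) ∧ R ⊆ Q}.ncard = 2 ^ n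

/-- The family `S` is sparse with constant `η`: there are pairwise disjoint measurable sets
`E_Q ⊆ Q`, `Q ∈ S`, with `|E_Q| ≥ η |Q|`. -/
def IsSparseFamily {n : ℕ} (η : ℝ≥0) (S : Set (Set (EuclideanSpace ℝ (Fin n)))) : Prop :=
  ∃ E : Set (EuclideanSpace ℝ (Fin n)) → Set (EuclideanSpace ℝ (Fin n)),
    (∀ Q ∈ S, E Q ⊆ Q ∧ MeasurableSet (E Q) ∧ (η : ℝ≥0∞) * volume Q ≤ volume (E Q)) ∧
    S.PairwiseDisjoint E

/-- The integrand `y ↦ ∏ⱼ (bⱼ(x) - bⱼ(y)) · f(y) / |x - y| ^ (n - α)` of `I_{α,b} f(x)`. -/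
def fracCommutatorIntegrand {n m : ℕ} (α : ℝ) (b : Fin m → EuclideanSpace ℝ (Fin n) → ℂ)
    (f : EuclideanSpace ℝ (Fin n) → ℂ) (x y : EuclideanSpace ℝ (Fin n)) : ℂ :=
  (∏ j, (b j x - b j y)) * (f y / ((‖x - y‖ ^ ((n : ℝ) - α) : ℝ) : ℂ))

/-- The general iterated commutator `I_{α,b} f(x)` of the fractional integral operator. -/
def fracCommutator {n m : ℕ} (α : ℝ) (b : Fin m → EuclideanSpace ℝ (Fin n) → ℂ)
    (f : EuclideanSpace ℝ (Fin n) → ℂ) (x : EuclideanSpace ℝ (Fin n)) : ℂ :=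
  ∫ y, fracCommutatorIntegrand α b f x y

/-- The sparse operator `T^{α,τ}_{S,b} f(x)`, a sum of nonnegative terms with values in `[0, ∞]`. -/
def sparseOperator {n m : ℕ} (S : Set (Set (EuclideanSpace ℝ (Fin n))))
    (b : Fin m → EuclideanSpace ℝ (Fin n) → ℂ) (α : ℝ) (τ : Finset (Fin m))
    (f : EuclideanSpace ℝ (Fin n) → ℂ) (x : EuclideanSpace ℝ (Fin n)) : ℝ≥0∞ :=
  ∑' Q : S, (Q : Set (EuclideanSpace ℝ (Fin n))).indicator
    (fun z => volume (Q : Set (EuclideanSpace ℝ (Fin n))) ^ (α / (n : ℝ)) *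
      ((∏ i ∈ τ, ‖b i z - ⨍ w in (Q : Set (EuclideanSpace ℝ (Fin n))), b i w ∂volume‖ₑ) *
        ⨍⁻ y in (Q : Set (EuclideanSpace ℝ (Fin n))),
          (∏ l ∈ τᶜ, ‖b l y - ⨍ w in (Q : Set (EuclideanSpace ℝ (Fin n))), b l w ∂volume‖ₑ) * ‖f y‖ₑ ∂volume)) x

end

/-! By the one-third trick, the kernel `|x - y| ^ (α - n)` is at most `6 ^ (n - α)` times the sum,
over `3 ^ n` shifted grids and all scales, of the dyadic kernels `|Q| ^ (α/n - 1)`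
(`exists_shift_scale_kernel_le`). It therefore suffices to bound, in each grid, a sum over all
dyadic cubes `Q` containing `x`. Writing `b(x) - b(y)` as a difference of oscillations about `(b)_P`
and expanding the product, each term is controlled by averages over `Q` of the weights `g P τ`, with
the reference cube `P` free to choose (`setLAverage_prod_le_sum`).

Below a stopping cube `P`, a cube stops if some average of `g P τ` exceeds `K` times the average
over `P` when it lies exactly `L` generations below `P`, and `K ^ 2` times when it lies further
down. The family keeps every cube less than `L` generations below its stopping cube; there `P = Q`
is used. Any other small cube, `s ≥ L` generations below `P`, is charged to `P` at cost `K ^ 2 * 2 ^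
(-α s)`. Once `L` is so large that `K ^ 2 * 2 ^ (-α L) ≤ 1`, these costs sum to at most a geometric
series free of `m`; only the sparseness constant sees `K` and `L`
(`tsum_scale_le_tsum_stoppingFamily`).

Sparseness rests on the maximal inequality: stopping cubes cover at most half of a stopping cube,
and, thanks to the gap between `K` and `K ^ 2`, at most half of any non-stopping cube `L`
generations below one. Every small kept cube contains a cube of the latter kind at most `2 * L`
generations down (`exists_stopIndex_add_eq_of_lt`), whose uncovered half supplies its set `E_Q`.
Large cubes are handled by `exists_stable_scale`. -/

/-! ### Shifted dyadic grids -/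

/-- Three times the offset, in units of `2 ^ k`, of the shifted dyadic grid at scale `k`. -/
def gridShift (t k : ℤ) : ℤ := if Even k then t else -t

lemma gridShift_succ (t k : ℤ) : gridShift t (k + 1) = -gridShift t k := by
  unfold gridShift
  by_cases h : Even k <;> simp [h]

section Grid

variable {n : ℕ} (t : Fin n → ℤ)

/-- The index of the cube of scale `k` containing `x` in the grid with shift `t`. -/
noncomputable def gridIndex (k : ℤ) (x : EuclideanSpace ℝ (Fin n)) : Fin n → ℤ :=
  fun i => ⌊x i / (2 : ℝ) ^ k - (gridShift (t i) k : ℝ) / 3⌋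

/-- The cube of scale `k` containing `x` in the grid with shift `t`. -/
noncomputable def gridCube (k : ℤ) (x : EuclideanSpace ℝ (Fin n)) :
    Set (EuclideanSpace ℝ (Fin n)) :=
  halfOpenCube
    (fun i => (2 : ℝ) ^ k * ((gridIndex t k x i : ℝ) + (gridShift (t i) k : ℝ) / 3)) ((2 : ℝ) ^ k)

/-- The family of all cubes of the grid with shift `t`. -/
def gridFamily : Set (Set (EuclideanSpace ℝ (Fin n))) := {Q | ∃ k x, Q = gridCube t k x}

lemma mem_gridCube {k : ℤ} {x y : EuclideanSpace ℝ (Fin n)} :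
    y ∈ gridCube t k x ↔ gridIndex t k y = gridIndex t k x := by
  have h2 : (0 : ℝ) < 2 ^ k := by positivity
  simp only [gridCube, halfOpenCube, Set.mem_ofPred_eq, Set.mem_Ico, funext_iff]
  refine forall_congr' fun i => ?_
  conv_rhs => rw [gridIndex]
  rw [Int.floor_eq_iff]
  have e : y i = (2 : ℝ) ^ k * (y i / (2 : ℝ) ^ k) := by field_simp
  set u := y i / (2 : ℝ) ^ k
  rw [e]
  constructor
  · rintro ⟨h, h'⟩
    have h1 := le_of_mul_le_mul_left h h2
    have h3 : u < ((gridIndex t k x i : ℝ) + (gridShift (t i) k : ℝ) / 3) + 1 := by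
      refine lt_of_mul_lt_mul_left (a := (2 : ℝ) ^ k) ?_ h2.le
      linarith
    constructor <;> linarith
  · rintro ⟨h, h'⟩
    constructor
    · exact mul_le_mul_of_nonneg_left (by linarith) h2.le
    · have := mul_lt_mul_of_pos_left (show u < ((gridIndex t k x i : ℝ) +
        (gridShift (t i) k : ℝ) / 3) + 1 by linarith) h2
      linarith

lemma self_mem_gridCube (k : ℤ) (x : EuclideanSpace ℝ (Fin n)) : x ∈ gridCube t k x :=
  (mem_gridCube t).2 rfl

lemma gridCube_congr {k : ℤ} {x y : EuclideanSpace ℝ (Fin n)}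
    (h : gridIndex t k y = gridIndex t k x) : gridCube t k y = gridCube t k x := by
  simp only [gridCube, h]

lemma gridCube_eq_of_mem {k : ℤ} {x y : EuclideanSpace ℝ (Fin n)} (h : y ∈ gridCube t k x) :
    gridCube t k y = gridCube t k x :=
  gridCube_congr t ((mem_gridCube t).1 h)

/-- The alternating sign of the shift is what nests the scales: `2 * s / 3` and `-s / 3` differ by
the integer `s`. All nesting properties of the grid follow from this recursion. -/
lemma gridIndex_succ (k : ℤ) (x : EuclideanSpace ℝ (Fin n)) (i : Fin n) :
    gridIndex t (k + 1) x i = (gridIndex t k x i + gridShift (t i) k) / 2 := by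
  have h2 : (2 : ℝ) ^ k ≠ 0 := by positivity
  have key : x i / (2 : ℝ) ^ (k + 1) - (gridShift (t i) (k + 1) : ℝ) / 3 =
      (x i / (2 : ℝ) ^ k - (gridShift (t i) k : ℝ) / 3 + (gridShift (t i) k : ℤ)) / (2 : ℕ) := by
    rw [gridShift_succ, zpow_add_one₀ (by norm_num)]
    push_cast
    field_simp
    ring
  rw [gridIndex, key, Int.floor_div_natCast, Int.floor_add_intCast]
  rfl

lemma gridIndex_eq_of_le {k l : ℤ} (hkl : k ≤ l) {x y : EuclideanSpace ℝ (Fin n)}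
    (h : gridIndex t k y = gridIndex t k x) : gridIndex t l y = gridIndex t l x := by
  induction l, hkl using Int.leInduction with
  | base => exact h
  | succ l _ ih => funext i; rw [gridIndex_succ, gridIndex_succ, ih]

lemma gridCube_subset_of_le {k l : ℤ} (hkl : k ≤ l) (x : EuclideanSpace ℝ (Fin n)) :
    gridCube t k x ⊆ gridCube t l x := fun _ hy =>
  (mem_gridCube t).2 (gridIndex_eq_of_le t hkl ((mem_gridCube t).1 hy))

lemma gridCube_subset_of_mem {k l : ℤ} (hkl : k ≤ l) {x y : EuclideanSpace ℝ (Fin n)}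
    (h : x ∈ gridCube t l y) : gridCube t k x ⊆ gridCube t l y :=
  (gridCube_subset_of_le t hkl x).trans (gridCube_eq_of_mem t h).subset

lemma exists_gridIndex_eq (k : ℤ) (v : Fin n → ℤ) :
    ∃ x : EuclideanSpace ℝ (Fin n), gridIndex t k x = v := by
  refine ⟨WithLp.toLp 2 fun i => (2 : ℝ) ^ k * ((v i : ℝ) + (gridShift (t i) k : ℝ) / 3), ?_⟩
  funext i
  have h2 : (2 : ℝ) ^ k ≠ 0 := by positivity
  simp [gridIndex, h2]

lemma halfOpenCube_eq_preimage (a : Fin n → ℝ) (ℓ : ℝ) :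
    halfOpenCube a ℓ = (WithLp.ofLp : EuclideanSpace ℝ (Fin n) → (Fin n → ℝ)) ⁻¹'
      (Set.univ.pi fun i => Set.Ico (a i) (a i + ℓ)) := by
  ext x; simp [halfOpenCube]

lemma measurableSet_halfOpenCube (a : Fin n → ℝ) (ℓ : ℝ) : MeasurableSet (halfOpenCube a ℓ) := by
  rw [halfOpenCube_eq_preimage]
  exact (PiLp.volume_preserving_ofLp (Fin n)).measurable
    (MeasurableSet.univ_pi fun i => measurableSet_Ico)

lemma volume_halfOpenCube (a : Fin n → ℝ) (ℓ : ℝ) :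
    volume (halfOpenCube a ℓ) = ENNReal.ofReal ℓ ^ n := by
  rw [halfOpenCube_eq_preimage, (PiLp.volume_preserving_ofLp (Fin n)).measure_preimage
    (MeasurableSet.univ_pi fun i => measurableSet_Ico).nullMeasurableSet, volume_pi_pi]
  simp

lemma measurableSet_gridCube (k : ℤ) (x : EuclideanSpace ℝ (Fin n)) :
    MeasurableSet (gridCube t k x) :=
  measurableSet_halfOpenCube _ _

lemma volume_gridCube (k : ℤ) (x : EuclideanSpace ℝ (Fin n)) :
    volume (gridCube t k x) = ENNReal.ofReal ((2 : ℝ) ^ k) ^ n :=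
  volume_halfOpenCube _ _

lemma volume_gridCube_ne_zero (k : ℤ) (x : EuclideanSpace ℝ (Fin n)) :
    volume (gridCube t k x) ≠ 0 := by
  rw [volume_gridCube]
  exact pow_ne_zero _ (by simp; positivity)

lemma volume_gridCube_ne_top (k : ℤ) (x : EuclideanSpace ℝ (Fin n)) :
    volume (gridCube t k x) ≠ ∞ := by
  rw [volume_gridCube]
  exact ENNReal.pow_ne_top ENNReal.ofReal_ne_top

/-- Cubes whose scales differ by `s` have volumes that differ by the factor `2 ^ (s * n)`. -/
lemma volume_gridCube_add (k : ℤ) (s : ℕ) (x y : EuclideanSpace ℝ (Fin n)) :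
    volume (gridCube t (k + s) x) = 2 ^ (s * n) * volume (gridCube t k y) := by
  rw [volume_gridCube, volume_gridCube, zpow_add₀ (by norm_num), ENNReal.ofReal_mul (by positivity),
    mul_pow, mul_comm, zpow_natCast, ENNReal.ofReal_pow (by norm_num), pow_mul]
  simp

lemma scale_eq_of_halfOpenCube_eq (hn : n ≠ 0) {a a' : Fin n → ℝ} {k l : ℤ}
    (h : halfOpenCube a ((2 : ℝ) ^ k) = halfOpenCube a' ((2 : ℝ) ^ l)) : k = l := by
  have h1 := congrArg volume h
  rw [volume_halfOpenCube, volume_halfOpenCube] at h1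
  have h2 := (ENNReal.pow_right_strictMono hn).injective h1
  rw [ENNReal.ofReal_eq_ofReal_iff (by positivity) (by positivity)] at h2
  exact zpow_right_injective₀ (by norm_num) (by norm_num) h2

lemma countable_range_gridCube (k : ℤ) : (Set.range (gridCube t k)).Countable := by
  refine Set.Countable.mono ?_ (Set.countable_range
    fun v : Fin n → ℤ => gridCube t k (exists_gridIndex_eq t k v).choose)
  rintro _ ⟨x, rfl⟩
  exact ⟨gridIndex t k x, gridCube_congr t (exists_gridIndex_eq t k _).choose_spec⟩

lemma cubesOfScale_gridFamily (hn : n ≠ 0) (k : ℤ) :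
    cubesOfScale (gridFamily t) k = Set.range (gridCube t k) := by
  ext Q
  constructor
  · rintro ⟨⟨l, x, rfl⟩, a, ha⟩
    obtain rfl := scale_eq_of_halfOpenCube_eq hn ha
    exact ⟨x, rfl⟩
  · rintro ⟨x, rfl⟩
    exact ⟨⟨k, x, rfl⟩, _, rfl⟩

lemma ncard_children_gridCube (k : ℤ) (x : EuclideanSpace ℝ (Fin n)) :
    {R | R ∈ Set.range (gridCube t (k - 1)) ∧ R ⊆ gridCube t k x}.ncard = 2 ^ n := by
  set v := gridIndex t k x with hv
  choose p hp using exists_gridIndex_eq t (k - 1)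
  -- Inverting `gridIndex_succ`: in each coordinate the indices `w` with `(w + shift) / 2 = v` are
  -- `2 * v - shift` and its successor.
  let φ : (Fin n → Fin 2) → Set (EuclideanSpace ℝ (Fin n)) := fun c =>
    gridCube t (k - 1) (p fun i => 2 * v i - gridShift (t i) (k - 1) + (c i : ℕ))
  have hφ : Function.Injective φ := by
    intro c d hcd
    have h := self_mem_gridCube t (k - 1)
      (p fun i => 2 * v i - gridShift (t i) (k - 1) + (c i : ℕ))
    change _ ∈ φ c at h
    rw [hcd, mem_gridCube, hp, hp] at h
    funext i
    have := congrFun h i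
    apply Fin.ext
    omega
  have hs : {R | R ∈ Set.range (gridCube t (k - 1)) ∧ R ⊆ gridCube t k x} = φ '' Set.univ := by
    have hsucc := gridIndex_succ t (k - 1)
    rw [sub_add_cancel] at hsucc
    ext R
    constructor
    · rintro ⟨⟨y, rfl⟩, hy⟩
      have h1 := (mem_gridCube t).1 (hy (self_mem_gridCube t (k - 1) y))
      have h3 : ∀ i, v i = (gridIndex t (k - 1) y i + gridShift (t i) (k - 1)) / 2 :=
        fun i => by rw [← hsucc, h1]
      refine ⟨fun i => ⟨(gridIndex t (k - 1) y i -
        (2 * v i - gridShift (t i) (k - 1))).toNat, by have := h3 i; omega⟩, trivial, ?_⟩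
      apply gridCube_congr
      rw [hp]
      funext i
      have := h3 i
      simp only
      omega
    · rintro ⟨c, -, rfl⟩
      refine ⟨⟨_, rfl⟩, gridCube_subset_of_mem t (by omega) ((mem_gridCube t).2 ?_)⟩
      funext i
      rw [hsucc, hp]
      change _ = v i
      have := (c i).2
      omega
  rw [hs, Set.ncard_image_of_injective _ hφ, Set.ncard_univ]
  simp

lemma isDyadicGrid_gridFamily (hn : n ≠ 0) : IsDyadicGrid (gridFamily t) where
  exists_scale := by
    rintro _ ⟨k, x, rfl⟩
    exact ⟨k, ⟨k, x, rfl⟩, _, rfl⟩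
  partition k := by
    rw [cubesOfScale_gridFamily t hn]
    refine ⟨?_, fun x => ⟨gridCube t k x, ⟨⟨x, rfl⟩, self_mem_gridCube t k x⟩, ?_⟩⟩
    · rintro ⟨x, hx⟩
      exact (hx ▸ self_mem_gridCube t k x : x ∈ (∅ : Set _))
    · rintro _ ⟨⟨y, rfl⟩, hy⟩
      exact (gridCube_eq_of_mem t hy).symm
  nested := by
    have aux : ∀ k l : ℤ, k ≤ l → ∀ x y, Disjoint (gridCube t k x) (gridCube t l y) ∨
        gridCube t k x ⊆ gridCube t l y := by
      intro k l hkl x y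
      by_cases h : x ∈ gridCube t l y
      · exact Or.inr (gridCube_subset_of_mem t hkl h)
      · refine Or.inl (Set.disjoint_left.2 fun z hz hz' => h ?_)
        rw [mem_gridCube] at hz hz' ⊢
        rw [← hz', gridIndex_eq_of_le t hkl hz]
    rintro _ ⟨k, x, rfl⟩ _ ⟨l, y, rfl⟩ -
    rcases le_total k l with h | h
    · exact (aux k l h x y).imp_right Or.inl
    · exact (aux l k h y x).imp (fun h => h.symm) Or.inr
  parent k Q hQ := by
    rw [cubesOfScale_gridFamily t hn] at hQ ⊢
    obtain ⟨x, rfl⟩ := hQ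
    refine ⟨gridCube t (k + 1) x, ⟨⟨x, rfl⟩, gridCube_subset_of_le t (by omega) x⟩, ?_⟩
    rintro _ ⟨⟨y, rfl⟩, hy⟩
    exact (gridCube_eq_of_mem t (hy (self_mem_gridCube t k x))).symm
  children k Q hQ := by
    rw [cubesOfScale_gridFamily t hn] at hQ ⊢
    obtain ⟨x, rfl⟩ := hQ
    exact ncard_children_gridCube t k x

lemma finite_image_gridIndex (k : ℤ) {s : Set (EuclideanSpace ℝ (Fin n))}
    (hs : Bornology.IsBounded s) : (gridIndex t k '' s).Finite := by
  obtain ⟨R, hR⟩ := hs.exists_norm_le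
  refine (Set.finite_Icc (fun i => ⌊-R / (2 : ℝ) ^ k - (gridShift (t i) k : ℝ) / 3⌋)
    (fun i => ⌊R / (2 : ℝ) ^ k - (gridShift (t i) k : ℝ) / 3⌋)).subset ?_
  rintro _ ⟨x, hx, rfl⟩
  have h : ∀ i, |x i| ≤ R := fun i => (PiLp.norm_apply_le x i).trans (hR x hx)
  refine ⟨fun i => Int.floor_le_floor ?_, fun i => Int.floor_le_floor ?_⟩ <;>
  · have := abs_le.1 (h i)
    gcongr
    linarith

end Grid

/-- Two reals at distance less than `1 / 3` are not separated by the integers or are not separated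
by the integers shifted by `e / 3`. -/
lemma floor_eq_or_floor_shift_eq {u v : ℝ} (h : |u - v| < 1 / 3) {e : ℝ} (he : e = 1 ∨ e = -1) :
    ⌊u⌋ = ⌊v⌋ ∨ ⌊u - e / 3⌋ = ⌊v - e / 3⌋ := by
  wlog huv : u ≤ v generalizing u v
  · exact (this (by rwa [abs_sub_comm]) (le_of_not_ge huv)).imp Eq.symm Eq.symm
  rw [abs_lt] at h
  by_cases hf : ⌊u⌋ = ⌊v⌋
  · exact Or.inl hf
  right
  have h1 : ⌊u⌋ < ⌊v⌋ := lt_of_le_of_ne (Int.floor_le_floor huv) hf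
  have h2 : u < ⌊v⌋ := Int.floor_lt.1 h1
  have h3 := Int.floor_le v
  -- Both points lie within `1 / 3` of the separating integer `⌊v⌋`, so no integer translated by `e
  -- / 3` separates them.
  rcases he with rfl | rfl
  · trans ⌊v⌋ - 1
    · rw [Int.floor_eq_iff]; push_cast; constructor <;> linarith
    · symm; rw [Int.floor_eq_iff]; push_cast; constructor <;> linarith
  · trans ⌊v⌋
    · rw [Int.floor_eq_iff]; constructor <;> linarith
    · symm; rw [Int.floor_eq_iff]; constructor <;> linarith

/-- The one-third trick: two points that are close at scale `k` lie in a common cube of scale `k`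
of one of the `3 ^ n` shifted grids. -/
lemma exists_shift_mem_gridCube {n : ℕ} (k : ℤ) {x y : EuclideanSpace ℝ (Fin n)}
    (h : 3 * ‖x - y‖ < (2 : ℝ) ^ k) :
    ∃ t : Fin n → Fin 3, y ∈ gridCube (fun i => ((t i : ℕ) : ℤ)) k x := by
  have h2 : (0 : ℝ) < 2 ^ k := by positivity
  have key : ∀ i, ∃ s : Fin 3, ⌊y i / (2 : ℝ) ^ k - (gridShift ((s : ℕ) : ℤ) k : ℝ) / 3⌋ =
      ⌊x i / (2 : ℝ) ^ k - (gridShift ((s : ℕ) : ℤ) k : ℝ) / 3⌋ := by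
    intro i
    have hi : |x i - y i| ≤ ‖x - y‖ := PiLp.norm_apply_le (x - y) i
    have hc : |y i / (2 : ℝ) ^ k - x i / (2 : ℝ) ^ k| < 1 / 3 := by
      rw [← sub_div, abs_div, abs_of_pos h2, div_lt_iff₀ h2, abs_sub_comm]
      linarith
    have he : ((gridShift 1 k : ℤ) : ℝ) = 1 ∨ ((gridShift 1 k : ℤ) : ℝ) = -1 := by
      unfold gridShift; split_ifs <;> simp
    -- The shifts `0` and `1` already suffice in each coordinate.
    rcases floor_eq_or_floor_shift_eq hc he with h | h
    · refine ⟨0, ?_⟩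
      have : gridShift ((((0 : Fin 3) : ℕ)) : ℤ) k = 0 := by unfold gridShift; simp
      rw [this]; simpa using h
    · exact ⟨1, h⟩
  choose s hs using key
  exact ⟨s, (mem_gridCube _).2 (funext hs)⟩

/-! ### Splitting sets of finite measure -/

/-- A bounded measurable set in `ℝⁿ`, `n ≥ 1`, has a measurable subset of half its measure. -/
lemma exists_subset_volume_eq_half {n : ℕ} (hn : n ≠ 0) {U : Set (EuclideanSpace ℝ (Fin n))}
    (hU : MeasurableSet U) (hb : Bornology.IsBounded U) :
    ∃ V ⊆ U, MeasurableSet V ∧ volume V = volume U / 2 := by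
  have : NeZero n := ⟨hn⟩
  obtain ⟨R, hR⟩ := hb.exists_norm_le
  have hfin : volume U ≠ ∞ := hb.measure_lt_top.ne
  have : IsFiniteMeasure (volume.restrict U) := ⟨by simpa using hb.measure_lt_top⟩
  let p : EuclideanSpace ℝ (Fin n) → ℝ := fun x => x 0
  have hp : Measurable p := by fun_prop
  let ν : Measure ℝ := (volume.restrict U).map p
  -- Hyperplanes are null, so the first coordinate has no atoms on `U`; hence `|U ∩ {x 0 ≤ s}|` is
  -- continuous in `s` and the intermediate value theorem applies.
  have : NullSingletonClass ν := by
    refine ⟨fun c => ?_⟩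
    rw [Measure.map_apply hp (measurableSet_singleton c)]
    refine le_antisymm ((Measure.restrict_apply_le _ _).trans ?_) bot_le
    have hpre : p ⁻¹' {c} = (WithLp.ofLp : EuclideanSpace ℝ (Fin n) → (Fin n → ℝ)) ⁻¹'
        {v | v 0 = c} := rfl
    rw [hpre, (PiLp.volume_preserving_ofLp (Fin n)).measure_preimage
      (measurableSet_eq_fun (measurable_pi_apply 0) measurable_const).nullMeasurableSet]
    exact (Measure.pi_hyperplane (fun _ : Fin n => (volume : Measure ℝ)) 0 c).le
  have hcont : Continuous fun s => ∫ _ in (-R - 1)..s, (1 : ℝ) ∂ν :=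
    intervalIntegral.continuous_primitive (fun a b => intervalIntegrable_const) _
  -- Starting at `-R - 1` keeps the open left end of `Ioc` away from `U`.
  have hval : ∀ s, -R - 1 ≤ s → ∫ _ in (-R - 1)..s, (1 : ℝ) ∂ν =
      (volume (U ∩ {x | x 0 ≤ s})).toReal := by
    intro s hs
    rw [intervalIntegral.integral_of_le hs, setIntegral_const, Measure.real,
      Measure.map_apply hp measurableSet_Ioc, Measure.restrict_apply (hp measurableSet_Ioc)]
    rw [smul_eq_mul, mul_one]
    congr 2
    ext x
    simp only [p, Set.mem_inter_iff, Set.mem_preimage, Set.mem_Ioc]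
    constructor
    · rintro ⟨⟨-, h⟩, hx⟩; exact ⟨hx, h⟩
    · rintro ⟨hx, h⟩
      have := abs_le.1 ((PiLp.norm_apply_le x 0).trans (hR x hx))
      exact ⟨⟨by linarith, h⟩, hx⟩
  rcases le_or_gt 0 R with hR0 | hR0
  swap
  · have : U = ∅ := Set.eq_empty_of_forall_notMem fun x hx =>
      absurd ((norm_nonneg x).trans (hR x hx)) (not_le.2 hR0)
    exact ⟨∅, Set.empty_subset _, MeasurableSet.empty, by simp [this]⟩
  have hle : -R - 1 ≤ R := by linarith
  have hall : U ∩ {x | x 0 ≤ R} = U := Set.inter_eq_left.2 fun x hx =>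
    (abs_le.1 ((PiLp.norm_apply_le x 0).trans (hR x hx))).2
  obtain ⟨s, hs, hse⟩ := intermediate_value_Icc hle hcont.continuousOn
    (show (volume U).toReal / 2 ∈ Set.Icc _ _ by
      rw [hval R hle, hall, intervalIntegral.integral_same]
      constructor <;> [positivity; exact half_le_self (by positivity)])
  have hse' := (hval s hs.1).symm.trans hse
  refine ⟨U ∩ {x | x 0 ≤ s}, Set.inter_subset_left,
    hU.inter (measurableSet_le hp measurable_const), ?_⟩
  rw [← ENNReal.toReal_eq_toReal_iff' (measure_ne_top_of_subset Set.inter_subset_left hfin)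
    (ENNReal.div_ne_top hfin (by norm_num)), hse']
  simp

/-- A bounded measurable set in `ℝⁿ`, `n ≥ 1`, splits into infinitely many disjoint measurable
pieces, the `i`-th of measure `2 ^ (-(i + 1))` times that of the set. -/
lemma exists_disjoint_pieces {n : ℕ} (hn : n ≠ 0) {U : Set (EuclideanSpace ℝ (Fin n))}
    (hU : MeasurableSet U) (hb : Bornology.IsBounded U) :
    ∃ V : ℕ → Set (EuclideanSpace ℝ (Fin n)), (∀ i, V i ⊆ U ∧ MeasurableSet (V i) ∧
      volume (V i) = volume U / 2 ^ (i + 1)) ∧ Pairwise (Function.onFun Disjoint V) := by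
  choose! H hH using fun (W : Set (EuclideanSpace ℝ (Fin n))) (h : MeasurableSet W ∧
    Bornology.IsBounded W) => exists_subset_volume_eq_half hn h.1 h.2
  let W : ℕ → Set (EuclideanSpace ℝ (Fin n)) := fun i => H^[i] U
  have hsucc : ∀ i, W (i + 1) = H (W i) := fun i => Function.iterate_succ_apply' H i U
  have hW : ∀ i, MeasurableSet (W i) ∧ Bornology.IsBounded (W i) ∧ W i ⊆ U ∧
      volume (W i) = volume U / 2 ^ i := by
    intro i
    induction i with
    | zero => exact ⟨hU, hb, subset_rfl, by simp [W]⟩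
    | succ i ih =>
      obtain ⟨h1, h2, h3⟩ := hH (W i) ⟨ih.1, ih.2.1⟩
      rw [hsucc]
      refine ⟨h2, ih.2.1.subset h1, h1.trans ih.2.2.1, ?_⟩
      rw [h3, ih.2.2.2, pow_succ, ENNReal.div_eq_inv_mul, ENNReal.div_eq_inv_mul,
        ENNReal.div_eq_inv_mul, ENNReal.mul_inv (by simp) (by simp)]
      ring
  have hsub : ∀ i, W (i + 1) ⊆ W i := fun i => by
    rw [hsucc]; exact (hH (W i) ⟨(hW i).1, (hW i).2.1⟩).1
  have hanti : Antitone W := antitone_nat_of_succ_le hsub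
  -- `W` is obtained by repeated halving; the pieces are its successive differences.
  refine ⟨fun i => W i \ W (i + 1), fun i => ⟨Set.sdiff_subset.trans (hW i).2.2.1,
    (hW i).1.diff (hW (i + 1)).1, ?_⟩, ?_⟩
  · have h3 := (hH (W i) ⟨(hW i).1, (hW i).2.1⟩).2.2
    rw [← hsucc] at h3
    rw [measure_sdiff (hsub i) (hW (i + 1)).1.nullMeasurableSet
      (hW (i + 1)).2.1.measure_lt_top.ne, h3, ENNReal.sub_half (hW i).2.1.measure_lt_top.ne,
      ← h3, (hW (i + 1)).2.2.2]
  · refine (pairwise_disjoint_on _).2 fun i j hij => Set.disjoint_left.2 fun x hx hx' => ?_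
    exact hx.2 (hanti (Nat.succ_le_of_lt hij) hx'.1)

/-! ### The dyadic maximal inequality -/

section Maximal

variable {n : ℕ} (t : Fin n → ℤ)

lemma isBounded_gridCube (k : ℤ) (x : EuclideanSpace ℝ (Fin n)) :
    Bornology.IsBounded (gridCube t k x) := by
  rw [gridCube, halfOpenCube_eq_preimage]
  refine (PiLp.antilipschitzWith_ofLp 2 (fun _ : Fin n => ℝ)).isBounded_preimage ?_
  exact Bornology.IsBounded.pi fun i => Metric.isBounded_Ico _ _

/-- Weak type (1,1) bound by Calderón–Zygmund selection: the maximal cubes with average above `c`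
are disjoint, cover the set and lie in the given cube. -/
lemma mul_volume_lt_setLAverage_le (h : EuclideanSpace ℝ (Fin n) → ℝ≥0∞) (c : ℝ≥0∞) (l : ℤ)
    (x : EuclideanSpace ℝ (Fin n)) :
    c * volume {z ∈ gridCube t l x | ∃ k < l, c < ⨍⁻ y in gridCube t k z, h y ∂volume} ≤
      ∫⁻ y in gridCube t l x, h y := by
  let M : Set (Set (EuclideanSpace ℝ (Fin n))) := {Q | ∃ k < l, ∃ z ∈ gridCube t l x,
    Q = gridCube t k z ∧ (c < ⨍⁻ y in gridCube t k z, h y ∂volume) ∧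
      ∀ k' < l, k < k' → ¬ c < ⨍⁻ y in gridCube t k' z, h y ∂volume}
  have hM : M.Countable := by
    refine (Set.countable_iUnion fun k => countable_range_gridCube t k).mono ?_
    rintro _ ⟨k, -, z, -, rfl, -⟩
    exact Set.mem_iUnion.2 ⟨k, z, rfl⟩
  have hcover : {z ∈ gridCube t l x | ∃ k < l, c < ⨍⁻ y in gridCube t k z, h y ∂volume} ⊆ ⋃ Q ∈ M, Q := by
    rintro z ⟨hz, k, hk⟩
    obtain ⟨k₁, hk₁, hmax⟩ := Int.exists_greatest_of_bdd
      (P := fun k => k < l ∧ c < ⨍⁻ y in gridCube t k z, h y ∂volume) ⟨l, fun z hz => hz.1.le⟩ ⟨k, hk⟩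
    exact Set.mem_biUnion (x := gridCube t k₁ z) ⟨k₁, hk₁.1, z, hz, rfl, hk₁.2,
      fun k' hk' hlt hc => absurd (hmax k' ⟨hk', hc⟩) (not_le.2 hlt)⟩ (self_mem_gridCube t k₁ z)
  have hdisj : M.PairwiseDisjoint id := by
    rintro _ ⟨k, hk, z, hz, rfl, hc, hm⟩ _ ⟨k', hk', z', hz', rfl, hc', hm'⟩ hne
    refine Set.disjoint_left.2 fun w hw hw' => hne ?_
    have e := gridCube_eq_of_mem t hw
    have e' := gridCube_eq_of_mem t hw'
    have aux : ∀ {k k' : ℤ} {z : EuclideanSpace ℝ (Fin n)}, k < k' → w ∈ gridCube t k z →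
        gridCube t k' w = gridCube t k' z := fun hlt hw =>
      gridCube_eq_of_mem t (gridCube_subset_of_le t hlt.le _ hw)
    rcases lt_trichotomy k k' with hlt | rfl | hlt
    · refine absurd ?_ (hm k' hk' hlt)
      rwa [← aux hlt hw, e']
    · rw [← e, ← e']
    · refine absurd ?_ (hm' k hk hlt)
      rwa [← aux hlt hw', e]
  have hmeas : ∀ Q ∈ M, MeasurableSet Q := by
    rintro _ ⟨k, -, z, -, rfl, -⟩
    exact measurableSet_gridCube t k z
  calc c * volume {z ∈ gridCube t l x | ∃ k < l, c < ⨍⁻ y in gridCube t k z, h y ∂volume}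
      ≤ c * ∑' Q : M, volume (Q : Set (EuclideanSpace ℝ (Fin n))) := by
        gcongr
        exact (measure_mono hcover).trans (measure_biUnion_le _ hM _)
    _ = ∑' Q : M, c * volume (Q : Set (EuclideanSpace ℝ (Fin n))) := ENNReal.tsum_mul_left.symm
    _ ≤ ∑' Q : M, ∫⁻ y in (Q : Set (EuclideanSpace ℝ (Fin n))), h y := by
        refine ENNReal.tsum_le_tsum ?_
        rintro ⟨_, k, hk, z, hz, rfl, hc, hm⟩
        rw [setLAverage_eq] at hc
        exact (ENNReal.le_div_iff_mul_le (Or.inl (volume_gridCube_ne_zero t k z))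
          (Or.inl (volume_gridCube_ne_top t k z))).1 hc.le
    _ = ∫⁻ y in ⋃ Q ∈ M, Q, h y := (lintegral_biUnion hM hmeas hdisj _).symm
    _ ≤ ∫⁻ y in gridCube t l x, h y := by
        refine lintegral_mono_set (Set.iUnion₂_subset ?_)
        rintro _ ⟨k, hk, z, hz, rfl, -⟩
        exact gridCube_subset_of_mem t hk.le hz

/-- If `c` is at least `K` times the average of `h` over a cube, the dyadic maximal function of `h`
exceeds `c` on at most the `K`-th part of the cube. -/
lemma volume_lt_setLAverage_le (h : EuclideanSpace ℝ (Fin n) → ℝ≥0∞) {c K : ℝ≥0∞} (hK : K ≠ 0)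
    (hK' : K ≠ ∞) (l : ℤ) (x : EuclideanSpace ℝ (Fin n))
    (hc : K * (⨍⁻ y in gridCube t l x, h y ∂volume) ≤ c) :
    volume {z ∈ gridCube t l x | ∃ k < l, c < ⨍⁻ y in gridCube t k z, h y ∂volume} ≤
      volume (gridCube t l x) / K := by
  have hv := volume_gridCube_ne_zero t l x
  have hv' := volume_gridCube_ne_top t l x
  have hI : ∫⁻ y in gridCube t l x, h y =
      (⨍⁻ y in gridCube t l x, h y ∂volume) * volume (gridCube t l x) := by
    rw [setLAverage_eq, ENNReal.div_mul_cancel hv hv']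
  -- The general argument cancels `c`, so `c = 0` and `c = ∞` are treated apart. Infinite averages
  -- can occur, since products of locally integrable functions need not be locally integrable.
  rcases eq_or_ne c 0 with rfl | hc0
  · have h0 : ∫⁻ y in gridCube t l x, h y = 0 := by
      rw [hI]
      have := (mul_eq_zero.1 (le_antisymm hc bot_le)).resolve_left hK
      rw [this, zero_mul]
    have hempty : {z ∈ gridCube t l x | ∃ k < l, 0 < ⨍⁻ y in gridCube t k z, h y ∂volume} = ∅ := by
      refine Set.eq_empty_of_forall_notMem ?_
      rintro z ⟨hz, k, hk, hpos⟩
      have : ∫⁻ y in gridCube t k z, h y = 0 := le_antisymm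
        ((lintegral_mono_set (gridCube_subset_of_mem t hk.le hz)).trans h0.le) bot_le
      rw [setLAverage_eq, this, ENNReal.zero_div] at hpos
      exact lt_irrefl _ hpos
    rw [hempty]; simp
  rcases eq_or_ne c ∞ with rfl | hct
  · simp
  have h1 := mul_volume_lt_setLAverage_le t h c l x
  set μ := volume {z ∈ gridCube t l x | ∃ k < l, c < ⨍⁻ y in gridCube t k z, h y ∂volume}
  rw [ENNReal.le_div_iff_mul_le (Or.inl hK) (Or.inl hK')]
  refine (ENNReal.mul_le_mul_iff_right hc0 hct).1 ?_
  calc c * (μ * K) = K * (c * μ) := by ring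
    _ ≤ K * ((⨍⁻ y in gridCube t l x, h y ∂volume) * volume (gridCube t l x)) := by
      rw [← hI]; gcongr
    _ = (K * ⨍⁻ y in gridCube t l x, h y ∂volume) * volume (gridCube t l x) := by ring
    _ ≤ c * volume (gridCube t l x) := by gcongr

end Maximal

/-! ### Stopping cubes -/

section Stopping

variable {n : ℕ} {ι : Type*} (t : Fin n → ℤ) (N : ℤ)
  (g : Set (EuclideanSpace ℝ (Fin n)) → ι → EuclideanSpace ℝ (Fin n) → ℝ≥0∞) (K : ℝ≥0∞) (L : ℕ)

/-- The cube containing `x` that lies `i` generations below the scale `N`. -/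
noncomputable def descendant (i : ℕ) (x : EuclideanSpace ℝ (Fin n)) :
    Set (EuclideanSpace ℝ (Fin n)) :=
  gridCube t (N - i) x

/-- With `P` the cube around `x` of generation `p`: the cube around `x` of generation `i ≥ p + L`
has an average of some weight `g P τ` that is too large compared with the average over `P`. -/
def IsStopping (i p : ℕ) (x : EuclideanSpace ℝ (Fin n)) : Prop :=
  p + L ≤ i ∧ ∃ τ, (if i = p + L then K else K ^ 2) *
      (⨍⁻ y in descendant t N p x, g (descendant t N p x) τ y ∂volume) <
    ⨍⁻ y in descendant t N i x, g (descendant t N p x) τ y ∂volume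

open Classical in
/-- The generation of the smallest stopping cube that contains the cube around `x` of
generation `i`. -/
noncomputable def stopIndex : ℕ → EuclideanSpace ℝ (Fin n) → ℕ
  | 0, _ => 0
  | i + 1, x => if IsStopping t N g K L (i + 1) (stopIndex i x) x then i + 1 else stopIndex i x

lemma descendant_eq_of_mem {i : ℕ} {x y : EuclideanSpace ℝ (Fin n)}
    (h : y ∈ descendant t N i x) : descendant t N i y = descendant t N i x :=
  gridCube_eq_of_mem t h

lemma self_mem_descendant (i : ℕ) (x : EuclideanSpace ℝ (Fin n)) : x ∈ descendant t N i x :=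
  self_mem_gridCube t _ x

lemma descendant_subset {i j : ℕ} (h : i ≤ j) (x : EuclideanSpace ℝ (Fin n)) :
    descendant t N j x ⊆ descendant t N i x :=
  gridCube_subset_of_le t (by omega) x

lemma descendant_eq_of_mem_of_le {i j : ℕ} (hj : j ≤ i) {x y : EuclideanSpace ℝ (Fin n)}
    (h : y ∈ descendant t N i x) : descendant t N j y = descendant t N j x :=
  descendant_eq_of_mem t N (descendant_subset t N hj x h)

lemma stopIndex_le (i : ℕ) (x : EuclideanSpace ℝ (Fin n)) : stopIndex t N g K L i x ≤ i := by
  induction i with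
  | zero => exact le_rfl
  | succ i ih =>
    rw [stopIndex]
    split_ifs
    · exact le_rfl
    · exact ih.trans (Nat.le_succ i)

lemma isStopping_congr {i p : ℕ} (hp : p ≤ i) {x y : EuclideanSpace ℝ (Fin n)}
    (h : y ∈ descendant t N i x) :
    IsStopping t N g K L i p y ↔ IsStopping t N g K L i p x := by
  rw [IsStopping, IsStopping, descendant_eq_of_mem t N h, descendant_eq_of_mem_of_le t N hp h]

/-- Whether a cube stops depends only on that cube and its ancestors, so the index is constant on
cubes. -/
lemma stopIndex_congr {i j : ℕ} (hj : j ≤ i) {x y : EuclideanSpace ℝ (Fin n)}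
    (h : y ∈ descendant t N i x) : stopIndex t N g K L j y = stopIndex t N g K L j x := by
  induction j with
  | zero => rfl
  | succ j ih =>
    rw [stopIndex, stopIndex, ih (by omega), isStopping_congr t N g K L
      ((stopIndex_le t N g K L j x).trans (Nat.le_succ j)) (descendant_subset t N hj x h)]

lemma stopIndex_succ_of_not {i : ℕ} {x : EuclideanSpace ℝ (Fin n)}
    (h : ¬IsStopping t N g K L (i + 1) (stopIndex t N g K L i x) x) :
    stopIndex t N g K L (i + 1) x = stopIndex t N g K L i x := by
  rw [stopIndex, if_neg h]

lemma not_isStopping_of_stopIndex_lt {i : ℕ} {x : EuclideanSpace ℝ (Fin n)}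
    (h : stopIndex t N g K L i x < i) :
    ¬IsStopping t N g K L i (stopIndex t N g K L i x) x := by
  cases i with
  | zero => omega
  | succ i =>
    rw [stopIndex] at h ⊢
    split_ifs at h ⊢ with hs
    · omega
    · exact hs

lemma stopIndex_stopIndex (i : ℕ) (x : EuclideanSpace ℝ (Fin n)) :
    stopIndex t N g K L (stopIndex t N g K L i x) x = stopIndex t N g K L i x := by
  induction i with
  | zero => rfl
  | succ i ih =>
    by_cases hs : IsStopping t N g K L (i + 1) (stopIndex t N g K L i x) x
    · have : stopIndex t N g K L (i + 1) x = i + 1 := by rw [stopIndex, if_pos hs]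
      rw [this, this]
    · rw [stopIndex_succ_of_not t N g K L hs, ih]

lemma stopIndex_eq_of_lt_add {i j : ℕ} (hij : i ≤ j) {x : EuclideanSpace ℝ (Fin n)}
    (h : j < stopIndex t N g K L i x + L) :
    stopIndex t N g K L j x = stopIndex t N g K L i x := by
  induction j, hij using Nat.le_induction with
  | base => rfl
  | succ j _ ih =>
    have := ih (by omega)
    rw [stopIndex_succ_of_not, this]
    rw [this]
    exact fun hs => absurd hs.1 (by omega)

/-- Until the index first changes the reference cube stays the same, so that first change is a stop
relative to the original reference cube. -/
lemma exists_isStopping_of_ne {j k : ℕ} (hjk : j ≤ k) {x : EuclideanSpace ℝ (Fin n)}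
    (h : stopIndex t N g K L k x ≠ stopIndex t N g K L j x) :
    ∃ i, j ≤ i ∧ IsStopping t N g K L (i + 1) (stopIndex t N g K L j x) x := by
  induction k, hjk using Nat.le_induction with
  | base => exact absurd rfl h
  | succ k hk ih =>
    by_cases h' : stopIndex t N g K L k x = stopIndex t N g K L j x
    · refine ⟨k, hk, ?_⟩
      by_contra hs
      rw [← h'] at hs
      exact h ((stopIndex_succ_of_not t N g K L hs).trans h')
    · exact ih h'

lemma measurableSet_of_descendant_subset {i : ℕ} {s : Set (EuclideanSpace ℝ (Fin n))}
    (h : ∀ x ∈ s, descendant t N i x ⊆ s) : MeasurableSet s := by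
  have hs : s = ⋃₀ (descendant t N i '' s) := by
    ext x
    constructor
    · exact fun hx => ⟨_, ⟨x, hx, rfl⟩, self_mem_descendant t N i x⟩
    · rintro ⟨_, ⟨y, hy, rfl⟩, hx⟩
      exact h y hy hx
  rw [hs]
  refine MeasurableSet.sUnion
    ((countable_range_gridCube t (N - i)).mono (Set.image_subset_range _ _)) ?_
  rintro _ ⟨y, -, rfl⟩
  exact measurableSet_gridCube t _ y

/-- The part of a cube of generation `j` that is not covered by smaller stopping cubes. -/
def unstopped (j : ℕ) (x : EuclideanSpace ℝ (Fin n)) : Set (EuclideanSpace ℝ (Fin n)) :=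
  {z ∈ descendant t N j x | ∀ k, j ≤ k → stopIndex t N g K L k z = stopIndex t N g K L j x}

lemma measurableSet_unstopped (j : ℕ) (x : EuclideanSpace ℝ (Fin n)) :
    MeasurableSet (unstopped t N g K L j x) := by
  have : unstopped t N g K L j x = descendant t N j x ∩
      ⋂ k, {z | j ≤ k → stopIndex t N g K L k z = stopIndex t N g K L j x} := by
    ext z; simp [unstopped]
  rw [this]
  refine (measurableSet_gridCube t _ x).inter (MeasurableSet.iInter fun k => ?_)
  refine measurableSet_of_descendant_subset t N (i := k) fun z hz y hy hjk => ?_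
  rw [stopIndex_congr t N g K L le_rfl hy, hz hjk]

variable [Fintype ι]

/-- Each weight contributes at most a `K`-th of the cube, and `K` is at least twice the number of
weights. -/
lemma volume_iUnion_large_average_le {p : Set (EuclideanSpace ℝ (Fin n))} (hK : K ≠ 0)
    (hK' : K ≠ ∞) (hι : 2 * (Fintype.card ι : ℝ≥0∞) ≤ K) (c : ι → ℝ≥0∞) (j : ℕ)
    (x : EuclideanSpace ℝ (Fin n))
    (hc : ∀ τ, K * (⨍⁻ y in descendant t N j x, g p τ y ∂volume) ≤ c τ) :
    volume (⋃ τ, {z ∈ descendant t N j x |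
      ∃ k < N - j, c τ < ⨍⁻ y in gridCube t k z, g p τ y ∂volume}) ≤
      volume (descendant t N j x) / 2 := by
  calc _ ≤ ∑ τ : ι, volume {z ∈ descendant t N j x |
        ∃ k < N - j, c τ < ⨍⁻ y in gridCube t k z, g p τ y ∂volume} :=
        measure_iUnion_fintype_le _ _
    _ ≤ ∑ τ : ι, volume (descendant t N j x) / K :=
        Finset.sum_le_sum fun τ _ => volume_lt_setLAverage_le t (g p τ) hK hK' _ x (hc τ)
    _ = (Fintype.card ι : ℝ≥0∞) * (volume (descendant t N j x) / K) := by
        simp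
    _ ≤ K / 2 * (volume (descendant t N j x) / K) := by
        gcongr
        rw [ENNReal.le_div_iff_mul_le (by simp) (by simp), mul_comm]
        exact hι
    _ = volume (descendant t N j x) / 2 := by
        rw [ENNReal.div_eq_inv_mul, ENNReal.div_eq_inv_mul, ENNReal.div_eq_inv_mul, mul_assoc,
          ← mul_assoc K, ENNReal.mul_inv_cancel hK hK', one_mul]

/-- A stopping cube is not exhausted by the stopping cubes `L` generations below it. -/
lemma exists_stopIndex_add_eq (hK' : K ≠ ∞) (h1 : 1 ≤ K)
    (hι : 2 * (Fintype.card ι : ℝ≥0∞) ≤ K) {p : ℕ} {x : EuclideanSpace ℝ (Fin n)}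
    (hp : stopIndex t N g K L p x = p) :
    ∃ y ∈ descendant t N p x, stopIndex t N g K L (p + L) y = p := by
  have hK : K ≠ 0 := (zero_lt_one.trans_le h1).ne'
  -- Otherwise every point would lie in a stopping cube relative to this one, hence in a cube whose
  -- average exceeds at least the smaller threshold; such cubes cover only half.
  by_contra! hcon
  have hsub : descendant t N p x ⊆ ⋃ τ, {z ∈ descendant t N p x | ∃ k < N - p,
      K * (⨍⁻ y in descendant t N p x, g (descendant t N p x) τ y ∂volume) <
        ⨍⁻ y in gridCube t k z, g (descendant t N p x) τ y ∂volume} := by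
    intro z hz
    have hzp : stopIndex t N g K L p z = p := (stopIndex_congr t N g K L le_rfl hz).trans hp
    obtain ⟨i, hi, -, τ, hτ⟩ := exists_isStopping_of_ne t N g K L (Nat.le_add_right p L)
      (x := z) (by rw [hzp]; exact hcon z hz)
    rw [hzp, descendant_eq_of_mem t N hz] at hτ
    refine Set.mem_iUnion.2 ⟨τ, hz, N - (i + 1 : ℕ), by push_cast; omega, lt_of_le_of_lt ?_ hτ⟩
    gcongr
    split_ifs
    · exact le_rfl
    · exact le_self_pow h1 two_ne_zero
  have h2 := (measure_mono hsub).trans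
    (volume_iUnion_large_average_le t N g K hK hK' hι _ p x fun τ => le_rfl)
  exact absurd h2 (not_le.2 (ENNReal.half_lt_self (volume_gridCube_ne_zero t _ x)
    (volume_gridCube_ne_top t _ x)))

/-- A cube that lies `L` generations below the smallest stopping cube containing it is covered at
most by half by smaller stopping cubes. -/
lemma half_volume_le_volume_unstopped (hL : 1 ≤ L) (hK : K ≠ 0) (hK' : K ≠ ∞)
    (hι : 2 * (Fintype.card ι : ℝ≥0∞) ≤ K) {j : ℕ} {x : EuclideanSpace ℝ (Fin n)}
    (hj : stopIndex t N g K L j x + L = j) :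
    volume (descendant t N j x) / 2 ≤ volume (unstopped t N g K L j x) := by
  set p := stopIndex t N g K L j x with hp
  have hv := volume_gridCube_ne_top t (N - j) x
  have hns := not_isStopping_of_stopIndex_lt t N g K L (i := j) (x := x) (by omega)
  rw [← hp] at hns
  have hc : ∀ τ, K * (⨍⁻ y in descendant t N j x, g (descendant t N p x) τ y ∂volume) ≤
      K ^ 2 * (⨍⁻ y in descendant t N p x, g (descendant t N p x) τ y ∂volume) := by
    intro τ
    -- One factor `K` is the bound given by not stopping at generation `p + L = j`; the other feeds
    -- the maximal inequality on the smaller cube.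
    rw [sq, mul_assoc]
    gcongr
    by_contra! hlt
    exact hns ⟨hj.le, τ, by rwa [if_pos hj.symm]⟩
  have hsub : descendant t N j x ⊆ unstopped t N g K L j x ∪
      ⋃ τ, {z ∈ descendant t N j x | ∃ k < N - j,
        K ^ 2 * (⨍⁻ y in descendant t N p x, g (descendant t N p x) τ y ∂volume) <
          ⨍⁻ y in gridCube t k z, g (descendant t N p x) τ y ∂volume} := by
    intro z hz
    by_cases hzu : z ∈ unstopped t N g K L j x
    · exact Or.inl hzu
    right
    have hzj : stopIndex t N g K L j z = p := stopIndex_congr t N g K L le_rfl hz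
    have : ∃ k, j ≤ k ∧ stopIndex t N g K L k z ≠ p := by
      by_contra! hcon
      exact hzu ⟨hz, hcon⟩
    obtain ⟨k, hk, hkne⟩ := this
    obtain ⟨i, hi, -, τ, hτ⟩ := exists_isStopping_of_ne t N g K L hk (x := z) (by rwa [hzj])
    -- The stop happens strictly below generation `p + L`, so its threshold is `K ^ 2`.
    rw [hzj, descendant_eq_of_mem_of_le t N (by omega) hz, if_neg (by omega)] at hτ
    exact Set.mem_iUnion.2 ⟨τ, hz, N - (i + 1 : ℕ), by push_cast; omega, hτ⟩
  have h1 := (measure_mono hsub).trans ((measure_union_le _ _).trans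
    (add_le_add_right (volume_iUnion_large_average_le t N g K hK hK' hι _ j x hc) _))
  refine (ENNReal.add_le_add_iff_right (a := volume (descendant t N j x) / 2)
    (ENNReal.div_ne_top hv two_ne_zero)).1 ?_
  rwa [ENNReal.add_halves]

end Stopping

/-! ### A scale beyond which a bounded set meets a stable number of cubes -/

/-- `F` need not fit into one cube of the grid, however large. But the number of cubes meeting `F`
attains its minimum at some scale, and from there on cubes meeting `F` never merge, because a
surjection between finite sets of equal size is injective. -/
lemma exists_stable_scale {n : ℕ} (t : Fin n → ℤ) {F : Set (EuclideanSpace ℝ (Fin n))}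
    (hF : Bornology.IsBounded F) :
    ∃ N : ℤ, ∀ k, N ≤ k → ∀ x ∈ F, ∀ y ∈ F, gridIndex t k x = gridIndex t k y →
      gridIndex t N x = gridIndex t N y := by
  obtain ⟨k₀, hk₀⟩ : ∃ k₀ : ℤ, ∀ k, (gridIndex t k₀ '' F).ncard ≤ (gridIndex t k '' F).ncard := by
    have h := Function.argmin_le (fun k : ℤ => (gridIndex t k '' F).ncard)
    exact ⟨_, fun k => h k⟩
  refine ⟨k₀, fun k hk x hx y hy hxy => ?_⟩
  choose p hp using exists_gridIndex_eq t k₀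
  have himg : gridIndex t k '' F = (fun v => gridIndex t k (p v)) '' (gridIndex t k₀ '' F) := by
    rw [Set.image_image]
    exact Set.image_congr fun z _ => (gridIndex_eq_of_le t hk (hp _)).symm
  have hinj : Set.InjOn (fun v => gridIndex t k (p v)) (gridIndex t k₀ '' F) := by
    refine Set.injOn_of_ncard_image_eq ?_ (finite_image_gridIndex t k₀ hF)
    rw [← himg]
    refine le_antisymm ?_ (hk₀ k)
    rw [himg]
    exact Set.ncard_image_le (finite_image_gridIndex t k₀ hF)
  refine hinj ⟨x, hx, rfl⟩ ⟨y, hy, rfl⟩ ?_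
  simp only [gridIndex_eq_of_le t hk (hp _), hxy]

/-! ### The sparse family -/

section SparseFamily

variable {n : ℕ} {ι : Type*} (t : Fin n → ℤ) (N : ℤ)
  (g : Set (EuclideanSpace ℝ (Fin n)) → ι → EuclideanSpace ℝ (Fin n) → ℝ≥0∞) (K : ℝ≥0∞) (L : ℕ)
  (F : Set (EuclideanSpace ℝ (Fin n)))

/-- The cubes of scale greater than `N` that meet `F`, together with, inside the cubes of scale `N`
that meet `F`, those cubes lying less than `L` generations below a stopping cube. -/
def stoppingFamily : Set (Set (EuclideanSpace ℝ (Fin n))) :=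
  {Q | (∃ k x, N < k ∧ x ∈ F ∧ Q = gridCube t k x) ∨
    ∃ i x, i < stopIndex t N g K L i x + L ∧ (gridCube t N x ∩ F).Nonempty ∧
      Q = descendant t N i x}

lemma stoppingFamily_subset : stoppingFamily t N g K L F ⊆ gridFamily t := by
  rintro _ (⟨k, x, -, -, rfl⟩ | ⟨i, x, -, -, rfl⟩)
  · exact ⟨k, x, rfl⟩
  · exact ⟨_, x, rfl⟩

variable [Fintype ι]

/-- Every near-descendant of a stopping cube contains, at most `2 * L` generations further down,
a cube lying exactly `L` generations below the smallest stopping cube around it. -/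
lemma exists_stopIndex_add_eq_of_lt (hL : 1 ≤ L) (hK' : K ≠ ∞) (h1 : 1 ≤ K)
    (hι : 2 * (Fintype.card ι : ℝ≥0∞) ≤ K) {i : ℕ} {x : EuclideanSpace ℝ (Fin n)}
    (hi : i < stopIndex t N g K L i x + L) :
    ∃ y ∈ descendant t N i x, ∃ j, i < j ∧ j ≤ i + 2 * L ∧ stopIndex t N g K L j y + L = j := by
  set p := stopIndex t N g K L i x with hp
  have hpi : p ≤ i := stopIndex_le t N g K L i x
  obtain ⟨l, hl⟩ : ∃ l, p + L = l + 1 := ⟨p + L - 1, by omega⟩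
  have hlx : stopIndex t N g K L l x = p := stopIndex_eq_of_lt_add t N g K L (by omega) (by omega)
  -- Either the cube at generation `p + L` does not stop and serves itself, or it is a new stopping
  -- cube and a suitable cube lies `L` generations below it, at `p + 2 * L`.
  by_cases hs : stopIndex t N g K L (l + 1) x = p
  · exact ⟨x, self_mem_descendant t N i x, l + 1, by omega, by omega, by omega⟩
  · have hs' : stopIndex t N g K L (l + 1) x = l + 1 := by
      by_contra hne
      refine hs ?_
      rw [stopIndex] at hne ⊢
      split_ifs at hne ⊢
      · exact absurd rfl hne
      · exact hlx
    obtain ⟨y, hy, hyl⟩ := exists_stopIndex_add_eq t N g K L hK' h1 hι hs'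
    exact ⟨y, descendant_subset t N (by omega) x hy, l + 1 + L, by omega, by omega, by rw [hyl]⟩

lemma isSparseFamily_stoppingFamily (hn : n ≠ 0) (hL : 1 ≤ L) (hK' : K ≠ ∞) (h1 : 1 ≤ K)
    (hι : 2 * (Fintype.card ι : ℝ≥0∞) ≤ K)
    (hN : ∀ k, N ≤ k → ∀ x ∈ F, ∀ y ∈ F, gridIndex t k x = gridIndex t k y →
      gridIndex t N x = gridIndex t N y) :
    IsSparseFamily ((2 ^ (2 * L * n + 2 * L + 1))⁻¹) (stoppingFamily t N g K L F) := by
  have hK : K ≠ 0 := (zero_lt_one.trans_le h1).ne'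
  have hbdd : ∀ j x, Bornology.IsBounded (unstopped t N g K L j x) := fun j x =>
    (isBounded_gridCube t (N - j) x).subset fun z hz => hz.1
  -- One unstopped set may serve cubes of several generations `i`; it is cut into disjoint pieces,
  -- and generation `i` receives piece `j - i - 1`.
  choose! V hV hVd using fun (U : Set (EuclideanSpace ℝ (Fin n)))
    (h : MeasurableSet U ∧ Bornology.IsBounded U) => exists_disjoint_pieces hn h.1 h.2
  have hV' : ∀ j x i, _ := fun j x i =>
    hV _ ⟨measurableSet_unstopped t N g K L j x, hbdd j x⟩ i
  have hVd' : ∀ j x, _ := fun j x =>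
    hVd _ ⟨measurableSet_unstopped t N g K L j x, hbdd j x⟩
  have hcoe : (((2 ^ (2 * L * n + 2 * L + 1))⁻¹ : ℝ≥0) : ℝ≥0∞) =
      ((2 : ℝ≥0∞) ^ (2 * L * n + 2 * L + 1))⁻¹ := by
    rw [ENNReal.coe_inv (by positivity)]; push_cast; rfl
  have key : ∀ Q ∈ stoppingFamily t N g K L F, ∃ E : Set (EuclideanSpace ℝ (Fin n)),
      (E ⊆ Q ∧ MeasurableSet E ∧ (((2 ^ (2 * L * n + 2 * L + 1))⁻¹ : ℝ≥0) : ℝ≥0∞) * volume Q ≤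
        volume E) ∧
      ((∃ k x, N < k ∧ x ∈ F ∧ Q = gridCube t k x ∧ E = gridCube t k x \ gridCube t (k - 1) x) ∨
        ∃ i j x, i < j ∧ (gridCube t N x ∩ F).Nonempty ∧ Q = descendant t N i x ∧
          stopIndex t N g K L j x + L = j ∧ E = V (unstopped t N g K L j x) (j - i - 1)) := by
    rintro Q (⟨k, x, hk, hx, rfl⟩ | ⟨i, x, hi, hx, rfl⟩)
    -- Above scale `N` only one child of a cube meets `F`. Removing it leaves at least half the cube
    -- and avoids every smaller cube that meets `F`.
    · refine ⟨_, ⟨Set.sdiff_subset, (measurableSet_gridCube t k x).diff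
        (measurableSet_gridCube t (k - 1) x), ?_⟩, Or.inl ⟨k, x, hk, hx, rfl, rfl⟩⟩
      have hvol := volume_gridCube_add t (k - 1) 1 x x
      rw [Nat.cast_one, sub_add_cancel, one_mul] at hvol
      have hhalf : volume (gridCube t (k - 1) x) ≤ volume (gridCube t k x) / 2 := by
        rw [ENNReal.le_div_iff_mul_le (by simp) (by simp), hvol, mul_comm]
        gcongr
        exact le_self_pow (by norm_num) hn
      rw [measure_sdiff (gridCube_subset_of_le t (by omega) x)
        (measurableSet_gridCube t _ x).nullMeasurableSet (volume_gridCube_ne_top t _ x)]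
      calc _ ≤ (2 : ℝ≥0∞)⁻¹ * volume (gridCube t k x) := by
            rw [hcoe]
            gcongr
            exact le_self_pow (by norm_num) (by omega)
        _ = volume (gridCube t k x) - volume (gridCube t k x) / 2 := by
            rw [ENNReal.sub_half (volume_gridCube_ne_top t k x), ENNReal.div_eq_inv_mul]
        _ ≤ _ := by gcongr
    · obtain ⟨y, hy, j, hij, hj, hyj⟩ :=
        exists_stopIndex_add_eq_of_lt t N g K L hL hK' h1 hι hi
      have hQ := descendant_eq_of_mem t N hy
      have hNy : gridCube t N y = gridCube t N x :=
        gridCube_eq_of_mem t (gridCube_subset_of_le t (by omega) x hy)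
      obtain ⟨hV1, hV2, hV3⟩ := hV' j y (j - i - 1)
      refine ⟨V (unstopped t N g K L j y) (j - i - 1), ⟨?_, hV2, ?_⟩,
        Or.inr ⟨i, j, y, hij, by rwa [hNy], hQ.symm, hyj, rfl⟩⟩
      · rw [← hQ]
        exact (hV1.trans fun z hz => hz.1).trans (descendant_subset t N hij.le y)
      · have hhalf := half_volume_le_volume_unstopped t N g K L hL hK hK' hι hyj
        have hvol : volume (descendant t N i x) =
            2 ^ ((j - i) * n) * volume (descendant t N j y) := by
          have := volume_gridCube_add t (N - j) (j - i) x y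
          rwa [show N - (j : ℤ) + ((j - i : ℕ) : ℤ) = N - i by omega] at this
        rw [hV3, hcoe, hvol, show j - i - 1 + 1 = j - i by omega]
        rw [ENNReal.le_div_iff_mul_le (by simp) (by simp)]
        refine le_trans ?_ hhalf
        rw [ENNReal.le_div_iff_mul_le (by simp) (by simp)]
        -- The three losses are the volume ratio `2 ^ ((j - i) * n)`, the piece `2 ^ (j - i)` and
        -- the unstopped half, with `j - i ≤ 2 * L`.
        have hpow : (2 : ℝ≥0∞) ^ ((j - i) * n + (j - i) + 1) ≤ 2 ^ (2 * L * n + 2 * L + 1) := by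
          refine pow_le_pow_right₀ (by norm_num) ?_
          have : (j - i) * n ≤ 2 * L * n := Nat.mul_le_mul_right n (by omega)
          omega
        calc _ = ((2 : ℝ≥0∞) ^ (2 * L * n + 2 * L + 1))⁻¹ * 2 ^ ((j - i) * n + (j - i) + 1) *
              volume (descendant t N j y) := by rw [pow_succ, pow_add]; ring
          _ ≤ ((2 : ℝ≥0∞) ^ (2 * L * n + 2 * L + 1))⁻¹ * 2 ^ (2 * L * n + 2 * L + 1) *
              volume (descendant t N j y) := by gcongr
          _ = volume (descendant t N j y) := by
              rw [ENNReal.inv_mul_cancel (by simp) (by simp), one_mul]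
  choose! E hE hE' using key
  refine ⟨E, hE, ?_⟩
  intro Q hQ Q' hQ' hne
  refine Set.disjoint_left.2 fun w hw hw' => hne ?_
  have large : ∀ {k k' : ℤ} {z x' : EuclideanSpace ℝ (Fin n)}, N ≤ k → k < k' → z ∈ F → x' ∈ F →
      w ∈ gridCube t k z → w ∉ gridCube t k' x' \ gridCube t (k' - 1) x' := by
    intro k k' z x' hk hkk hz hx' hwz hwx
    refine hwx.2 ?_
    rw [Set.mem_sdiff, mem_gridCube] at hwx
    rw [mem_gridCube] at hwz ⊢
    have hzx : gridIndex t k' z = gridIndex t k' x' := by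
      rw [← gridIndex_eq_of_le t hkk.le hwz, hwx.1]
    rw [gridIndex_eq_of_le t (show k ≤ k' - 1 by omega) hwz,
      gridIndex_eq_of_le t (show N ≤ k' - 1 by omega) (hN k' (by omega) z hz x' hx' hzx)]
  have top : ∀ {i j : ℕ} {y : EuclideanSpace ℝ (Fin n)}, i < j → (gridCube t N y ∩ F).Nonempty →
      w ∈ V (unstopped t N g K L j y) (j - i - 1) → ∃ z ∈ F, w ∈ gridCube t N z := by
    rintro i j y hij ⟨z, hzy, hz⟩ hw
    refine ⟨z, hz, ?_⟩
    rw [gridCube_eq_of_mem t hzy]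
    exact gridCube_subset_of_le t (by omega) y ((hV' j y (j - i - 1)).1 hw).1
  rcases hE' Q hQ with ⟨k, x, hk, hx, rfl, e⟩ | ⟨i, j, y, hij, hy, rfl, hyj, e⟩ <;>
    rcases hE' Q' hQ' with ⟨k', x', hk', hx', rfl, e'⟩ | ⟨i', j', y', hij', hy', rfl, hyj', e'⟩ <;>
    rw [e] at hw <;> rw [e'] at hw'
  · rcases lt_trichotomy k k' with hlt | rfl | hlt
    · exact absurd hw' (large hk.le hlt hx hx' hw.1)
    · rw [← gridCube_eq_of_mem t hw.1, ← gridCube_eq_of_mem t hw'.1]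
    · exact absurd hw (large hk'.le hlt hx' hx hw'.1)
  · obtain ⟨z, hz, hwz⟩ := top hij' hy' hw'
    exact absurd hw (large le_rfl hk hz hx hwz)
  · obtain ⟨z, hz, hwz⟩ := top hij hy hw
    exact absurd hw' (large le_rfl hk' hz hx' hwz)
  · have hu := (hV' j y (j - i - 1)).1 hw
    have hu' := (hV' j' y' (j' - i' - 1)).1 hw'
    -- At generation `max j j'` the stopping index at `w` equals both `j - L` and `j' - L`.
    have hjj : j = j' := by
      have a := hu.2 (max j j') (le_max_left _ _)
      have a' := hu'.2 (max j j') (le_max_right _ _)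
      omega
    subst hjj
    have hd : descendant t N j y = descendant t N j y' := by
      rw [← descendant_eq_of_mem t N hu.1, ← descendant_eq_of_mem t N hu'.1]
    have hU : unstopped t N g K L j y' = unstopped t N g K L j y := by
      have : stopIndex t N g K L j y = stopIndex t N g K L j y' := by omega
      simp only [unstopped, hd, this]
    rw [hU] at hw'
    have hii : i = i' := by
      by_contra hne'
      exact Set.disjoint_left.1 (hVd' j y (show j - i - 1 ≠ j - i' - 1 by omega)) hw hw'
    subst hii
    rw [← descendant_eq_of_mem_of_le t N hij.le hu.1, ← descendant_eq_of_mem_of_le t N hij.le hu'.1]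

end SparseFamily

/-! ### Sums over all cubes containing a point -/

section Domination

variable {n : ℕ} {ι : Type*} (t : Fin n → ℤ) (N : ℤ)
  (g : Set (EuclideanSpace ℝ (Fin n)) → ι → EuclideanSpace ℝ (Fin n) → ℝ≥0∞) (K : ℝ≥0∞) (L : ℕ)
  (F : Set (EuclideanSpace ℝ (Fin n)))

/-- The source of the geometric decay when a cube is charged to an ancestor `s` generations above.
-/
lemma volume_gridCube_rpow (hn : n ≠ 0) (α : ℝ) (k : ℤ) (s : ℕ) (x : EuclideanSpace ℝ (Fin n)) :
    volume (gridCube t k x) ^ (α / n) =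
      ((2 : ℝ≥0∞) ^ (-α)) ^ s * volume (gridCube t (k + s) x) ^ (α / n) := by
  have hn' : (n : ℝ) ≠ 0 := by exact_mod_cast hn
  rw [volume_gridCube_add t k s x x, ENNReal.mul_rpow_of_ne_top (by simp)
    (volume_gridCube_ne_top t k x), ← mul_assoc]
  have : ((2 : ℝ≥0∞) ^ (-α)) ^ s * ((2 : ℝ≥0∞) ^ (s * n)) ^ (α / n) = 1 := by
    rw [← ENNReal.rpow_natCast, ← ENNReal.rpow_natCast, ← ENNReal.rpow_mul, ← ENNReal.rpow_mul,
      ← ENNReal.rpow_add _ _ (by norm_num) (by norm_num)]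
    push_cast
    rw [show -α * s + s * n * (α / n) = 0 by field_simp; ring, ENNReal.rpow_zero]
  rw [this, one_mul]

lemma setLAverage_le_of_stopIndex_add_le (hL : 1 ≤ L) (h1 : 1 ≤ K) {i : ℕ}
    {x : EuclideanSpace ℝ (Fin n)} (h : stopIndex t N g K L i x + L ≤ i) (τ : ι) :
    ⨍⁻ y in descendant t N i x, g (descendant t N (stopIndex t N g K L i x) x) τ y ∂volume ≤
      K ^ 2 * (⨍⁻ y in descendant t N (stopIndex t N g K L i x) x,
        g (descendant t N (stopIndex t N g K L i x) x) τ y ∂volume) := by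
  have hns := not_isStopping_of_stopIndex_lt t N g K L (i := i) (x := x) (by omega)
  by_contra! hlt
  refine hns ⟨h, τ, lt_of_le_of_lt ?_ hlt⟩
  gcongr
  split_ifs
  · exact le_self_pow h1 two_ne_zero
  · exact le_rfl

open Classical in
/-- A sum over all dyadic cubes containing `x` is dominated by the sum over the stopping family. -/
lemma tsum_scale_le_tsum_stoppingFamily [Fintype ι] (hn : n ≠ 0) (hL : 1 ≤ L) (h1 : 1 ≤ K) {α : ℝ}
    (hKL : K ^ 2 * ((2 : ℝ≥0∞) ^ (-α)) ^ L ≤ 1)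
    (u : Set (EuclideanSpace ℝ (Fin n)) → ι → ℝ≥0∞) (B : ℤ → ℝ≥0∞)
    (x : EuclideanSpace ℝ (Fin n))
    (hB : ∀ k P, B k ≤ ∑ τ, u P τ * ⨍⁻ y in gridCube t k x, g P τ y ∂volume)
    (hB0 : ∀ k, Disjoint (gridCube t k x) F → B k = 0) :
    ∑' k : ℤ, volume (gridCube t k x) ^ (α / n) * B k ≤
      (1 + (1 - (2 : ℝ≥0∞) ^ (-α))⁻¹) * ∑' Q : stoppingFamily t N g K L F,
        (Q : Set (EuclideanSpace ℝ (Fin n))).indicator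
          (fun _ => volume (Q : Set (EuclideanSpace ℝ (Fin n))) ^ (α / n) *
            ∑ τ, u Q τ * ⨍⁻ y in (Q : Set (EuclideanSpace ℝ (Fin n))), g Q τ y ∂volume) x := by
  set r : ℝ≥0∞ := (2 : ℝ≥0∞) ^ (-α) with hr
  let S := stoppingFamily t N g K L F
  let H : Set (EuclideanSpace ℝ (Fin n)) → ℝ≥0∞ := fun Q =>
    volume Q ^ (α / n) * ∑ τ, u Q τ * ⨍⁻ y in Q, g Q τ y ∂volume
  let G : ℤ → ℝ≥0∞ := fun k => if gridCube t k x ∈ S then H (gridCube t k x) else 0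
  -- The cost of charging a cube to its ancestor `s` generations up: `s = 0` for cubes of the
  -- family, `s ≥ L` for cubes charged to their stopping cube.
  let w : ℕ → ℝ≥0∞ := fun s => (if s = 0 then 1 else 0) + (if L ≤ s then K ^ 2 * r ^ s else 0)
  have hw0 : 1 ≤ w 0 := by simp [w]
  have own : ∀ k, gridCube t k x ∈ S →
      volume (gridCube t k x) ^ (α / n) * B k ≤ ∑' s : ℕ, w s * G (k + s) := by
    intro k hk
    refine le_trans ?_ (ENNReal.le_tsum 0)
    have hG : G (k + (0 : ℕ)) = H (gridCube t k x) := by simp [G, hk]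
    rw [hG]
    calc _ ≤ H (gridCube t k x) := by
          simp only [H]; gcongr; exact hB k _
      _ ≤ _ := le_mul_of_one_le_left' hw0
  have hterm : ∀ k, volume (gridCube t k x) ^ (α / n) * B k ≤ ∑' s : ℕ, w s * G (k + s) := by
    intro k
    rcases lt_or_ge N k with hk | hk
    · by_cases hd : Disjoint (gridCube t k x) F
      · simp [hB0 k hd]
      · obtain ⟨z, hz, hzF⟩ := Set.not_disjoint_iff.1 hd
        exact own k (Or.inl ⟨k, z, hk, hzF, (gridCube_eq_of_mem t hz).symm⟩)
    by_cases hd : Disjoint (gridCube t N x) F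
    · simp [hB0 k (hd.mono_left (gridCube_subset_of_le t hk x))]
    have hne : (gridCube t N x ∩ F).Nonempty := Set.not_disjoint_iff_nonempty_inter.1 hd
    obtain ⟨i, rfl⟩ : ∃ i : ℕ, k = N - i := ⟨(N - k).toNat, by omega⟩
    by_cases hi : i < stopIndex t N g K L i x + L
    · exact own _ (Or.inr ⟨i, x, hi, hne, rfl⟩)
    rw [not_lt] at hi
    set p := stopIndex t N g K L i x with hp
    have hpp : stopIndex t N g K L p x = p := stopIndex_stopIndex t N g K L i x
    have hscale : N - (i : ℤ) + ((i - p : ℕ) : ℤ) = N - p := by omega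
    have hpS : gridCube t (N - p) x ∈ S :=
      Or.inr ⟨p, x, by omega, hne, rfl⟩
    refine le_trans ?_ (ENNReal.le_tsum (i - p))
    have hG : G (N - (i : ℤ) + ((i - p : ℕ) : ℤ)) = H (gridCube t (N - p) x) := by
      rw [hscale]; simp [G, hpS]
    have hw : w (i - p) = K ^ 2 * r ^ (i - p) := by
      simp only [w]
      rw [if_neg (by omega), if_pos (by omega), zero_add]
    rw [hG, hw, volume_gridCube_rpow t hn α _ (i - p) x, hscale]
    calc _ ≤ r ^ (i - p) * volume (gridCube t (N - p) x) ^ (α / n) *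
          ∑ τ, u (gridCube t (N - p) x) τ * (K ^ 2 *
            ⨍⁻ y in gridCube t (N - p) x, g (gridCube t (N - p) x) τ y ∂volume) := by
          gcongr
          refine (hB _ (gridCube t (N - p) x)).trans (Finset.sum_le_sum fun τ _ => ?_)
          gcongr
          exact setLAverage_le_of_stopIndex_add_le t N g K L hL h1 hi τ
      _ = _ := by
          simp only [H, Finset.mul_sum]
          refine Finset.sum_congr rfl fun τ _ => ?_
          ring
  have hwsum : ∑' s, w s ≤ 1 + (1 - r)⁻¹ := by
    rw [ENNReal.tsum_add]
    gcongr
    · rw [tsum_ite_eq]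
    -- With `s = j + L`, the factor `K ^ 2 * r ^ L ≤ 1` disappears, leaving a bound independent of
    -- `K` and `L`.
    · have hle : ∀ s, (if L ≤ s then K ^ 2 * r ^ s else 0) ≤
          ∑' j, if s = j + L then r ^ j else 0 := by
        intro s
        split_ifs with hs
        · refine le_trans ?_ (ENNReal.le_tsum (s - L))
          rw [if_pos (by omega)]
          calc K ^ 2 * r ^ s = K ^ 2 * r ^ L * r ^ (s - L) := by
                rw [mul_assoc, ← pow_add, Nat.add_sub_cancel' hs]
            _ ≤ 1 * r ^ (s - L) := by gcongr
            _ = _ := one_mul _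
        · exact zero_le
      calc _ ≤ ∑' s, ∑' j, (if s = j + L then r ^ j else 0) := ENNReal.tsum_le_tsum hle
        _ = ∑' j, ∑' s, (if s = j + L then r ^ j else 0) := ENNReal.tsum_comm
        _ = ∑' j, r ^ j := by simp only [tsum_ite_eq]
        _ = (1 - r)⁻¹ := ENNReal.tsum_geometric r
  have hGsum : ∑' k, G k ≤ ∑' Q : S, (Q : Set (EuclideanSpace ℝ (Fin n))).indicator
      (fun _ => H Q) x := by
    let φ : {k : ℤ // gridCube t k x ∈ S} → S := fun k => ⟨gridCube t k x, k.2⟩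
    have hφ : Function.Injective φ := by
      intro k l hkl
      exact Subtype.ext (scale_eq_of_halfOpenCube_eq hn (congrArg Subtype.val hkl))
    refine le_trans (le_of_eq ?_) (ENNReal.tsum_comp_le_tsum_of_injective hφ _)
    have : ∀ k : {k : ℤ // gridCube t k x ∈ S}, ((φ k : S) : Set _).indicator
        (fun _ => H (φ k : S)) x = H (gridCube t k x) := fun k =>
      Set.indicator_of_mem (self_mem_gridCube t k x) _
    simp only [this]
    exact (tsum_subtype {k : ℤ | gridCube t k x ∈ S} fun k => H (gridCube t k x)).symm
  calc _ ≤ ∑' k : ℤ, ∑' s : ℕ, w s * G (k + s) := ENNReal.tsum_le_tsum hterm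
    _ = ∑' s : ℕ, ∑' k : ℤ, w s * G (k + s) := ENNReal.tsum_comm
    _ = ∑' s : ℕ, w s * ∑' k : ℤ, G k := by
        refine tsum_congr fun s => ?_
        rw [ENNReal.tsum_mul_left, ← (Equiv.addRight (s : ℤ)).tsum_eq G]
        rfl
    _ = (∑' s : ℕ, w s) * ∑' k : ℤ, G k := ENNReal.tsum_mul_right
    _ ≤ _ := by gcongr

end Domination

/-! ### The kernel of the fractional integral -/

/-- The kernel of the fractional integral is dominated by the sum of the dyadic kernels of the
`3 ^ n` shifted grids. -/
lemma exists_shift_scale_kernel_le {n : ℕ} (hn : n ≠ 0) {α : ℝ} (hα : α < n)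
    {x y : EuclideanSpace ℝ (Fin n)} (hxy : x ≠ y) :
    ∃ (t : Fin n → Fin 3) (k : ℤ), y ∈ gridCube (fun i => ((t i : ℕ) : ℤ)) k x ∧
      ENNReal.ofReal ((‖x - y‖ ^ ((n : ℝ) - α))⁻¹) ≤ ENNReal.ofReal (6 ^ ((n : ℝ) - α)) *
        (volume (gridCube (fun i => ((t i : ℕ) : ℤ)) k x) ^ (α / n) /
          volume (gridCube (fun i => ((t i : ℕ) : ℤ)) k x)) := by
  have hd : 0 < ‖x - y‖ := norm_pos_iff.2 (sub_ne_zero.2 hxy)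
  have hn' : (n : ℝ) ≠ 0 := by exact_mod_cast hn
  -- Here `2 ^ k ≤ 3 * ‖x - y‖ < 2 ^ (k + 1)`: scale `k + 1` is large enough for the one-third
  -- trick, and its side is at most `6 * ‖x - y‖`.
  obtain ⟨k, hk, hk'⟩ := exists_mem_Ico_zpow (show 0 < 3 * ‖x - y‖ by positivity)
    (one_lt_two (α := ℝ))
  obtain ⟨t, ht⟩ := exists_shift_mem_gridCube (k + 1) hk'
  refine ⟨t, k + 1, ht, ?_⟩
  have h2 : (0 : ℝ) < 2 ^ (k + 1) := by positivity
  have hv : volume (gridCube (fun i => ((t i : ℕ) : ℤ)) (k + 1) x) ^ (α / n) /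
      volume (gridCube (fun i => ((t i : ℕ) : ℤ)) (k + 1) x) =
      ENNReal.ofReal (((2 : ℝ) ^ (k + 1)) ^ (α - n)) := by
    rw [volume_gridCube, ← ENNReal.ofReal_pow h2.le, ENNReal.ofReal_rpow_of_pos (by positivity),
      ← ENNReal.ofReal_div_of_pos (by positivity), ← Real.rpow_natCast, ← Real.rpow_mul h2.le,
      Real.rpow_sub h2, mul_div_cancel₀ _ hn']
  rw [hv, ← ENNReal.ofReal_mul (by positivity)]
  refine ENNReal.ofReal_le_ofReal ?_
  have h6 : (2 : ℝ) ^ (k + 1) ≤ 6 * ‖x - y‖ := by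
    rw [zpow_add_one₀ two_ne_zero]; linarith
  have h3 : ((2 : ℝ) ^ (k + 1)) ^ ((n : ℝ) - α) ≤ 6 ^ ((n : ℝ) - α) * ‖x - y‖ ^ ((n : ℝ) - α) := by
    rw [← Real.mul_rpow (by norm_num) hd.le]
    exact Real.rpow_le_rpow h2.le h6 (by linarith)
  rw [show α - (n : ℝ) = -((n : ℝ) - α) by ring, Real.rpow_neg h2.le, ← div_eq_mul_inv,
    inv_eq_one_div, div_le_div_iff₀ (by positivity) (by positivity), one_mul]
  exact h3

lemma lintegral_enorm_fracCommutatorIntegrand_le {n m : ℕ} (hn : n ≠ 0) {α : ℝ} (hα : α < n)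
    {b : Fin m → EuclideanSpace ℝ (Fin n) → ℂ} (hb : ∀ i, AEStronglyMeasurable (b i) volume)
    {f : EuclideanSpace ℝ (Fin n) → ℂ} (hf : AEStronglyMeasurable f volume)
    (x : EuclideanSpace ℝ (Fin n)) :
    ∫⁻ y, ‖fracCommutatorIntegrand α b f x y‖ₑ ≤ ENNReal.ofReal (6 ^ ((n : ℝ) - α)) *
      ∑ t : Fin n → Fin 3, ∑' k : ℤ,
        volume (gridCube (fun i => ((t i : ℕ) : ℤ)) k x) ^ (α / n) *
          ⨍⁻ y in gridCube (fun i => ((t i : ℕ) : ℤ)) k x,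
            (∏ j, ‖b j x - b j y‖ₑ) * ‖f y‖ₑ ∂volume := by
  set c := ENNReal.ofReal (6 ^ ((n : ℝ) - α))
  let h : EuclideanSpace ℝ (Fin n) → ℝ≥0∞ := fun y => (∏ j, ‖b j x - b j y‖ₑ) * ‖f y‖ₑ
  have hh : AEMeasurable h := by
    refine AEMeasurable.mul (Finset.aemeasurable_fun_prod _ fun j _ => ?_) hf.enorm
    exact (aestronglyMeasurable_const.sub (hb j)).enorm
  let Q : (Fin n → Fin 3) → ℤ → Set (EuclideanSpace ℝ (Fin n)) :=
    fun t k => gridCube (fun i => ((t i : ℕ) : ℤ)) k x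
  let κ : (Fin n → Fin 3) → ℤ → ℝ≥0∞ := fun t k => volume (Q t k) ^ (α / n) / volume (Q t k)
  have hQ : ∀ t k, MeasurableSet (Q t k) := fun t k => measurableSet_gridCube _ k x
  have hpt : ∀ y, ‖fracCommutatorIntegrand α b f x y‖ₑ ≤
      c * ∑ t, ∑' k, κ t k * (Q t k).indicator h y := by
    intro y
    have hnorm : ‖fracCommutatorIntegrand α b f x y‖ₑ =
        ENNReal.ofReal ((‖x - y‖ ^ ((n : ℝ) - α))⁻¹) * h y := by
      have e : ‖(((‖x - y‖ ^ ((n : ℝ) - α) : ℝ) : ℂ))⁻¹‖ₑ =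
          ENNReal.ofReal ((‖x - y‖ ^ ((n : ℝ) - α))⁻¹) := by
        rw [← ofReal_norm, norm_inv, Complex.norm_real, Real.norm_of_nonneg (by positivity)]
      have e' : ‖∏ j, (b j x - b j y)‖ₑ = ∏ j, ‖b j x - b j y‖ₑ := by
        simp only [enorm, nnnorm_prod, ENNReal.ofNNReal_finsetProd]
      rw [fracCommutatorIntegrand, div_eq_mul_inv, enorm_mul, enorm_mul, e, e']
      simp only [h]
      ring
    rw [hnorm]
    rcases eq_or_ne x y with rfl | hxy
    -- On the diagonal the convention `0⁻¹ = 0` makes the integrand vanish.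
    · rw [sub_self, norm_zero, Real.zero_rpow (by linarith [hα]), inv_zero]
      simp
    obtain ⟨t, k, hy, hle⟩ := exists_shift_scale_kernel_le hn hα hxy
    calc _ ≤ c * κ t k * h y := by gcongr
      _ = c * (κ t k * (Q t k).indicator h y) := by
          rw [Set.indicator_of_mem (show y ∈ Q t k from hy), mul_assoc]
      _ ≤ c * ∑' k, κ t k * (Q t k).indicator h y := by
          gcongr
          exact ENNReal.le_tsum (f := fun k => κ t k * (Q t k).indicator h y) k
      _ ≤ _ := by
          gcongr
          exact Finset.single_le_sum
            (f := fun t => ∑' k, κ t k * (Q t k).indicator h y) (fun _ _ => zero_le)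
            (Finset.mem_univ t)
  have hm : ∀ t k, AEMeasurable (fun y => κ t k * (Q t k).indicator h y) := fun t k =>
    (hh.indicator (hQ t k)).const_mul _
  calc _ ≤ ∫⁻ y, c * ∑ t, ∑' k, κ t k * (Q t k).indicator h y := lintegral_mono hpt
    _ = c * ∑ t, ∑' k, ∫⁻ y, κ t k * (Q t k).indicator h y := by
        rw [lintegral_const_mul' _ _ ENNReal.ofReal_ne_top, lintegral_finsetSum' _
          fun t _ => AEMeasurable.tsum fun k => hm t k]
        simp only [lintegral_tsum (hm _)]
        rfl
    _ = _ := by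
        congr 1
        refine Finset.sum_congr rfl fun t _ => tsum_congr fun k => ?_
        rw [lintegral_const_mul'' _ (hh.indicator (hQ t k)), lintegral_indicator (hQ t k),
          setLAverage_eq]
        simp only [κ, Q, h, ENNReal.div_eq_inv_mul]
        ring

/-! ### Sparse domination -/

/-- The weight `∏_{l ∉ τ} |b_l - (b_l)_P| |f|`. -/
noncomputable def oscillationWeight {n m : ℕ} (b : Fin m → EuclideanSpace ℝ (Fin n) → ℂ)
    (f : EuclideanSpace ℝ (Fin n) → ℂ) (P : Set (EuclideanSpace ℝ (Fin n)))
    (τ : Finset (Fin m)) (y : EuclideanSpace ℝ (Fin n)) : ℝ≥0∞ :=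
  (∏ l ∈ τᶜ, ‖b l y - ⨍ w in P, b l w ∂volume‖ₑ) * ‖f y‖ₑ

lemma setLAverage_prod_le_sum {n m : ℕ} {b : Fin m → EuclideanSpace ℝ (Fin n) → ℂ}
    (hb : ∀ i, AEStronglyMeasurable (b i) volume) {f : EuclideanSpace ℝ (Fin n) → ℂ}
    (hf : AEStronglyMeasurable f volume) (Q P : Set (EuclideanSpace ℝ (Fin n)))
    (x : EuclideanSpace ℝ (Fin n)) :
    ⨍⁻ y in Q, (∏ j, ‖b j x - b j y‖ₑ) * ‖f y‖ₑ ∂volume ≤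
      ∑ τ : Finset (Fin m), (∏ i ∈ τ, ‖b i x - ⨍ w in P, b i w ∂volume‖ₑ) *
        ⨍⁻ y in Q, oscillationWeight b f P τ y ∂volume := by
  have hw : ∀ τ, AEMeasurable (oscillationWeight b f P τ) := by
    intro τ
    refine AEMeasurable.mul (Finset.aemeasurable_fun_prod _ fun j _ => ?_) hf.enorm
    exact ((hb j).sub aestronglyMeasurable_const).enorm
  have hpt : ∀ y, (∏ j, ‖b j x - b j y‖ₑ) * ‖f y‖ₑ ≤
      ∑ τ : Finset (Fin m), (∏ i ∈ τ, ‖b i x - ⨍ w in P, b i w ∂volume‖ₑ) *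
        oscillationWeight b f P τ y := by
    intro y
    simp only [oscillationWeight, ← mul_assoc]
    -- The sum over subsets `τ` is the expansion of `∏ (|b_j(x) - (b_j)_P| + |b_j(y) - (b_j)_P|)`.
    rw [← Finset.sum_mul, ← Fintype.prod_add]
    gcongr with j
    rw [show b j x - b j y = (b j x - ⨍ w in P, b j w ∂volume) -
      (b j y - ⨍ w in P, b j w ∂volume) by ring]
    exact enorm_sub_le
  rw [setLAverage_eq]
  calc _ ≤ (∫⁻ y in Q, ∑ τ : Finset (Fin m), (∏ i ∈ τ, ‖b i x - ⨍ w in P, b i w ∂volume‖ₑ) *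
        oscillationWeight b f P τ y) / volume Q := by
        gcongr
        exact hpt _
    _ = _ := by
        rw [lintegral_finsetSum' _ fun τ _ => ((hw τ).restrict.const_mul _),
          ENNReal.div_eq_inv_mul, Finset.mul_sum]
        refine Finset.sum_congr rfl fun τ _ => ?_
        rw [lintegral_const_mul'' _ (hw τ).restrict, setLAverage_eq, ENNReal.div_eq_inv_mul]
        ring

lemma aestronglyMeasurable_fracCommutatorIntegrand {n m : ℕ} (α : ℝ)
    {b : Fin m → EuclideanSpace ℝ (Fin n) → ℂ} (hb : ∀ i, AEStronglyMeasurable (b i) volume)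
    {f : EuclideanSpace ℝ (Fin n) → ℂ} (hf : AEStronglyMeasurable f volume)
    (x : EuclideanSpace ℝ (Fin n)) :
    AEStronglyMeasurable (fracCommutatorIntegrand α b f x) volume := by
  unfold fracCommutatorIntegrand
  refine AEStronglyMeasurable.mul ?_ (AEMeasurable.aestronglyMeasurable ?_)
  · exact Finset.aestronglyMeasurable_fun_prod _ fun j _ => aestronglyMeasurable_const.sub (hb j)
  · exact hf.aemeasurable.div (by fun_prop)

theorem mainTheorem8 (n : ℕ) (α : ℝ) (hα : 0 < α) (hαn : α < (n : ℝ)) :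
    ∃ C : ℝ≥0, ∀ m : ℕ, ∃ η : ℝ≥0, 0 < η ∧ η < 1 ∧
      ∀ b : Fin m → EuclideanSpace ℝ (Fin n) → ℂ,
        (∀ i, LocallyIntegrable (b i) volume) →
        ∀ f : EuclideanSpace ℝ (Fin n) → ℂ, MemLp f ∞ volume → HasCompactSupport f →
          ∃ D S : Fin (3 ^ n) → Set (Set (EuclideanSpace ℝ (Fin n))),
            (∀ j, IsDyadicGrid (D j) ∧ S j ⊆ D j ∧ IsSparseFamily η (S j)) ∧
            ∀ x : EuclideanSpace ℝ (Fin n),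
              ‖fracCommutator α b f x‖ₑ ≤
                  C * ∑ j, ∑ τ : Finset (Fin m), sparseOperator (S j) b α τ f x ∧
              (∑ j, ∑ τ : Finset (Fin m), sparseOperator (S j) b α τ f x < ∞ →
                Integrable (fracCommutatorIntegrand α b f x) volume) := by
  have hn : n ≠ 0 := by
    rintro rfl
    simp only [Nat.cast_zero] at hαn
    linarith
  set r : ℝ≥0∞ := (2 : ℝ≥0∞) ^ (-α) with hr
  have hr1 : r < 1 := ENNReal.rpow_lt_one_of_one_lt_of_neg (by norm_num) (by linarith)
  have hC : ENNReal.ofReal (6 ^ ((n : ℝ) - α)) * (1 + (1 - r)⁻¹) ≠ ∞ := by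
    refine ENNReal.mul_ne_top ENNReal.ofReal_ne_top (ENNReal.add_ne_top.2 ⟨by norm_num, ?_⟩)
    exact ENNReal.inv_ne_top.2 (tsub_pos_of_lt hr1).ne'
  refine ⟨(ENNReal.ofReal (6 ^ ((n : ℝ) - α)) * (1 + (1 - r)⁻¹)).toNNReal, fun m => ?_⟩
  rw [ENNReal.coe_toNNReal hC]
  -- Twice the number `2 ^ m` of weights, one for each `τ`.
  set K : ℝ≥0∞ := 2 ^ (m + 1) with hK
  have hK' : K ≠ ∞ := by simp [hK]
  have h1 : 1 ≤ K := one_le_pow₀ (by norm_num)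
  have hι : 2 * (Fintype.card (Finset (Fin m)) : ℝ≥0∞) ≤ K := by
    simp [hK, pow_succ, mul_comm]
  obtain ⟨L, hL, hKL⟩ : ∃ L : ℕ, 1 ≤ L ∧ K ^ 2 * r ^ L ≤ 1 := by
    have ht : Filter.Tendsto (fun L : ℕ => K ^ 2 * r ^ L) Filter.atTop (nhds (K ^ 2 * 0)) :=
      ENNReal.Tendsto.const_mul (ENNReal.tendsto_pow_atTop_nhds_zero_of_lt_one hr1)
        (Or.inr (ENNReal.pow_ne_top hK'))
    rw [mul_zero] at ht
    exact ((Filter.eventually_ge_atTop 1).and (ht.eventually_le_const zero_lt_one)).exists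
  refine ⟨(2 ^ (2 * L * n + 2 * L + 1))⁻¹, by positivity, ?_, fun b hb f hf hfs => ?_⟩
  · exact inv_lt_one_of_one_lt₀ (one_lt_pow₀ (by norm_num) (by omega))
  have hb' := fun i => (hb i).aestronglyMeasurable
  have hf' := hf.aestronglyMeasurable
  let T : (Fin n → Fin 3) → Fin n → ℤ := fun t i => ((t i : ℕ) : ℤ)
  choose N hN using fun t => exists_stable_scale (T t) hfs.isBounded
  let S : (Fin n → Fin 3) → Set (Set (EuclideanSpace ℝ (Fin n))) := fun t =>
    stoppingFamily (T t) (N t) (oscillationWeight b f) K L (tsupport f)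
  refine ⟨fun j => gridFamily (T (finFunctionFinEquiv.symm j)),
    fun j => S (finFunctionFinEquiv.symm j), fun j => ⟨isDyadicGrid_gridFamily _ hn,
      stoppingFamily_subset _ _ _ _ _ _,
      isSparseFamily_stoppingFamily _ _ _ _ _ _ hn hL hK' h1 hι (hN _)⟩, fun x => ?_⟩
  rw [finFunctionFinEquiv.symm.sum_comp fun t => ∑ τ, sparseOperator (S t) b α τ f x]
  -- Bounding the integral of the absolute value yields both the pointwise estimate and absolute
  -- convergence.
  have hbound : ∫⁻ y, ‖fracCommutatorIntegrand α b f x y‖ₑ ≤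
      ENNReal.ofReal (6 ^ ((n : ℝ) - α)) * (1 + (1 - r)⁻¹) *
        ∑ t, ∑ τ, sparseOperator (S t) b α τ f x := by
    refine (lintegral_enorm_fracCommutatorIntegrand_le hn hαn hb' hf' x).trans ?_
    rw [mul_assoc, Finset.mul_sum (a := 1 + (1 - r)⁻¹)]
    gcongr with t
    refine (tsum_scale_le_tsum_stoppingFamily (T t) (N t) (oscillationWeight b f) K L (tsupport f)
      hn hL h1 hKL (fun P τ => ∏ i ∈ τ, ‖b i x - ⨍ w in P, b i w ∂volume‖ₑ)
      (fun k => ⨍⁻ y in gridCube (T t) k x, (∏ j, ‖b j x - b j y‖ₑ) * ‖f y‖ₑ ∂volume) x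
      (fun k P => setLAverage_prod_le_sum hb' hf' _ P x) ?_).trans (le_of_eq ?_)
    · intro k hk
      rw [setLAverage_eq, setLIntegral_congr_fun (g := fun _ => 0)
        (measurableSet_gridCube (T t) k x), lintegral_zero, ENNReal.zero_div]
      intro y hy
      simp [image_eq_zero_of_notMem_tsupport (Set.disjoint_left.1 hk hy)]
    · congr 1
      simp only [sparseOperator]
      rw [← Summable.tsum_finsetSum fun τ _ => ENNReal.summable]
      refine tsum_congr fun Q => ?_
      by_cases hx : x ∈ (Q : Set (EuclideanSpace ℝ (Fin n)))
      · simp only [Set.indicator_of_mem hx, Finset.mul_sum]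
        rfl
      · simp only [Set.indicator_of_notMem hx, Finset.sum_const_zero]
  refine ⟨(enorm_integral_le_lintegral_enorm _).trans hbound, fun hfin => ⟨?_, ?_⟩⟩
  · exact aestronglyMeasurable_fracCommutatorIntegrand α hb' hf' x
  · exact hbound.trans_lt (ENNReal.mul_lt_top hC.lt_top hfin)
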